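/- Let $1\to\mathbb T\xrightarrow{\iota}\widehat\Gamma\xrightarrow{q}\Gamma\to1$ be a central extension of (Banach) Lie groups, with $q$ a locally trivial principal $\mathbb T$-bundle, and let $\sigma:\mathrm{Lie}\,\Gamma\to\mathrm{Lie}\,\widehat\Gamma$ be a (continuous) linear split of $0\to i\mathbb R\to\mathrm{Lie}\,\widehat\Gamma\xrightarrow{q_*}\mathrm{Lie}\,\Gamma\to0$. Put $\mathrm{Ad}_\gamma:=\mathrm{Ad}_{\hat\gamma}$ on $\mathrm{Lie}\,\widehat\Gamma$ for any lift $\hat\gamma$ of $\gamma\in\Gamma$, and $$Z_\sigma(\gamma,\xi)=\mathrm{Ad}_\gamma\sigma(\xi)-\sigma(\mathrm{Ad}_\gamma\xi)\in i\mathbb R,\qquad \omega_\sigma(\xi,\eta)=[\sigma\xi,\sigma\eta]-\sigma[\xi,\eta]\in i\mathbb R,\qquad \nu_\sigma=\hat\mu-\sigma(q^*\mu),$$ where $\mu,\hat\mu$ are the (left) Maurer–Cartan forms of $\Gamma,\widehat\Gamma$. Let $X$ be a smooth manifold and $(B,\theta,L)$ a principal $\Gamma$-bundle $\pi:B\to X$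 with a connection $\theta$ and a splitting $L$, i.e. a vector bundle map $L:B\times_{\mathrm{Ad}}\mathrm{Lie}\,\widehat\Gamma\to B\times_{\mathrm{Ad}}i\mathbb R$ over $X$ that is the identity on $B\times_{\mathrm{Ad}}i\mathbb R$. The associated lifting bundle gerbe $(J_B,\nabla_{\theta,\sigma},f_{\theta,\sigma})$ over $X$ is the following. Let $B^{[2]}=B\times_XB$ with projections $\pi_1,\pi_2$ to $B$, and let $\zeta:B^{[2]}\to\Gamma$ be given by $b_1\zeta(b_1,b_2)=b_2$. Then $J_B=\zeta^*\widehat\Gamma$ is a $\mathbb T$-bundle over $B^{[2]}$ with product induced by the multiplication of $\widehat\Gamma$; its connection is $$\nabla_{\theta,\sigma}=\zeta^*\nu_\sigma+Z_\sigma(\zeta^{-1},\pi_1^*\theta)$$ (pulled back to $J_B$), and its curving is the $2$-form on $B$ $$f_{\theta,\sigma}=-\tfrac12\,\omega_\sigma(\theta,\theta)-\ell_\sigma(F_\theta),\qquad F_\theta=d\theta+\tfrac12[\theta,\theta],\qquad L[b,\sigma(\xi)]=[b,\ell_\sigma(b,\xi)].$$ Let $\varphi:X'\to X$ be a smooth map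 of smooth manifolds, with covering map $\tilde\varphi:\varphi^*B\to B$. Let $\varphi^*(B,\theta,L)=(\varphi^*B,\tilde\varphi^*\theta,\varphi^*L)$, where $\varphi^*L$ is the splitting induced by $L$ through the natural isomorphism $\varphi^*(B\times_{\mathrm{Ad}}\mathrm{Lie}\,\widehat\Gamma)\cong(\varphi^*B)\times_{\mathrm{Ad}}\mathrm{Lie}\,\widehat\Gamma$ and its analogue for $i\mathbb R$, and let $\varphi^*(J_B,\nabla_{\theta,\sigma},f_{\theta,\sigma})=((\tilde\varphi^{[2]})^*J_B,(\tilde\varphi^{[2]})^*\nabla_{\theta,\sigma},\tilde\varphi^*f_{\theta,\sigma})$. **Theorem.** There are isomorphisms of bundle gerbes with connection and curving over $X'$ $$\Phi_{\varphi,(B,\theta,L)}:\ \varphi^*(J_B,\nabla_{\theta,\sigma},f_{\theta,\sigma})\ \xrightarrow{\ \cong\ }\ (J_{\varphi^*B},\nabla_{\tilde\varphi^*\theta,\sigma},f_{\tilde\varphi^*\theta,\sigma})$$ for all $X,X',\varphi,(B,\theta,L)$, that is, isomorphisms of $\mathbb T$-bundles covering the map induced on fibre products by a diffeomorphism over $X'$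 and carrying products, connections and curvings to each other, such that: 1. $\Phi_{\varphi,(B,\theta,L)}$ lies over the identity of $\varphi^*B$, and composed with the map $J_{\varphi^*B}\to J_B$ induced by $\tilde\varphi$ it is the canonical map $\varphi^*J_B\to J_B$; 2. $\Phi$ is natural: whenever $\varphi\circ a'=a\circ\varphi_1$ for smooth maps $a:X_1\to X$, $a':X_1'\to X'$, $\varphi_1:X_1'\to X_1$, and $\beta:B_1\to B$ is a morphism of principal $\Gamma$-bundles covering $a$ (where $(B_1,\theta_1,L_1)$ is a $\Gamma$-bundle over $X_1$ with connection and splitting), the maps $\varphi_1^*J_{B_1}\to\varphi^*J_B$ and $J_{\varphi_1^*B_1}\to J_{\varphi^*B}$ induced by $\beta$ and $a'$ commute with $\Phi_{\varphi_1,(B_1,\theta_1,L_1)}$ and $\Phi_{\varphi,(B,\theta,L)}$. -/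

import Mathlib

open Bundle (Trivialization)
open scoped Manifold ContDiff Topology

universe u v u₁ v₁ u₂ v₂ u₃ v₃ w z

set_option linter.checkUnivs false

noncomputable section

/-- A smooth manifold without boundary, modelled on a (possibly infinite-dimensional) real normed
space. -/
structure Mfd where
  carrier : Type u
  modelSpace : Type v
  chartSpace : Type v
  [normed : NormedAddCommGroup modelSpace]
  [normedSpace : NormedSpace ℝ modelSpace]
  [chartTop : TopologicalSpace chartSpace]
  I : ModelWithCorners ℝ modelSpace chartSpace
  [boundaryless : I.Boundaryless]
  [top : TopologicalSpace carrier]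
  [charted : ChartedSpace chartSpace carrier]
  [isManifold : IsManifold I ∞ carrier]

namespace Mfd

instance : CoeSort Mfd.{u, v} (Type u) := ⟨Mfd.carrier⟩

attribute [instance] normed normedSpace chartTop boundaryless top charted isManifold

/-- Smooth maps. -/
abbrev Hom (M : Mfd.{u₁, v₁}) (N : Mfd.{u₂, v₂}) := ContMDiffMap M.I N.I M N ∞

/-- The product manifold. -/
abbrev prod (M : Mfd.{u₁, v₁}) (N : Mfd.{u₂, v₂}) : Mfd.{max u₁ u₂, max v₁ v₂} where
  carrier := M × N
  modelSpace := M.modelSpace × N.modelSpace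
  chartSpace := ModelProd M.chartSpace N.chartSpace
  I := M.I.prod N.I
  boundaryless := inferInstance

end Mfd

/-- A smooth chart of `Y` adapted to `π : Y → X`: it identifies `π`, on an open set, with the
projection of an open subset of `X × F` to `X`. -/
structure IsProductChart {Y : Mfd.{u₁, v₁}} {X : Mfd.{u₂, v₂}} (π : Y.Hom X) (F : Mfd.{w, z})
    (e : OpenPartialHomeomorph Y (X × F)) : Prop where
  fst_eq : ∀ y ∈ e.source, (e y).1 = π y
  smooth : ContMDiffOn Y.I (X.I.prod F.I) ∞ e e.source
  smooth_symm : ContMDiffOn (X.I.prod F.I) Y.I ∞ e.symm e.target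

/-- `π` is a submersion: locally on `Y` it is the projection of a product with factor `F`. -/
def IsSubm {Y : Mfd.{u₁, v₁}} {X : Mfd.{u₂, v₂}} (π : Y.Hom X) (F : Mfd.{w, z}) : Prop :=
  ∀ y : Y, ∃ e : OpenPartialHomeomorph Y (X × F), IsProductChart π F e ∧ y ∈ e.source

section FibProd

variable {N : Mfd.{u, v}} {X : Mfd.{u₂, v₂}} {Y : Mfd.{u₁, v₁}} {F : Mfd.{w, z}}

/-- The underlying space of the fibre product `N ×_X Y`, with the subspace topology. -/
abbrev FibProdSet (f : N.Hom X) (π : Y.Hom X) : Type (max u u₁) :=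
  {p : N × Y // f p.1 = π p.2}

variable (f : N.Hom X) (π : Y.Hom X)


open Classical in
/-- A product chart `e` of `Y → X` induces the chart `(n, y) ↦ (n, (e y).2)` of `N ×_X Y` with
values in `N × F`. The point `p₀` only serves as a value of the inverse outside the target. -/
def pullChart (e : OpenPartialHomeomorph Y (X × F)) (he : IsProductChart π F e)
    (p₀ : FibProdSet f π) : OpenPartialHomeomorph (FibProdSet f π) (N × F) where
  toFun p := (p.1.1, (e p.1.2).2)
  invFun q :=
    if h : (f q.1, q.2) ∈ e.target then
      ⟨(q.1, e.symm (f q.1, q.2)), by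
        have := he.fst_eq _ (e.map_target h)
        rw [e.right_inv h] at this
        exact this⟩
    else p₀
  source := {p | p.1.2 ∈ e.source}
  target := {q | (f q.1, q.2) ∈ e.target}
  map_source' := by
    rintro ⟨⟨n, y⟩, hp⟩ (hy : y ∈ e.source)
    have : (f n, (e y).2) = e y := Prod.ext (hp.trans (he.fst_eq y hy).symm) rfl
    change (f n, (e y).2) ∈ e.target
    rw [this]
    exact e.map_source hy
  map_target' := by
    intro q (hq : (f q.1, q.2) ∈ e.target)
    simp [hq, e.map_target hq]
  left_inv' := by
    rintro ⟨⟨n, y⟩, hp⟩ (hy : y ∈ e.source)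
    have : (f n, (e y).2) = e y := Prod.ext (hp.trans (he.fst_eq y hy).symm) rfl
    simp [this, e.map_source hy, e.left_inv hy]
  right_inv' := by
    intro q (hq : (f q.1, q.2) ∈ e.target)
    simp [hq]
  open_source := e.open_source.preimage (continuous_snd.comp continuous_subtype_val)
  open_target := e.open_target.preimage
    (((ContMDiffMap.contMDiff f).continuous.comp continuous_fst).prodMk continuous_snd)
  continuousOn_toFun := by
    refine (continuous_fst.comp continuous_subtype_val).continuousOn.prodMk ?_
    exact continuous_snd.comp_continuousOn (e.continuousOn.comp
      (continuous_snd.comp continuous_subtype_val).continuousOn (fun _ h => h))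
  continuousOn_invFun := by
    refine (Topology.IsInducing.subtypeVal (t := {p : N × Y | f p.1 = π p.2})).continuousOn_iff.2 ?_
    refine ContinuousOn.congr (f := fun q : N × F => (q.1, e.symm (f q.1, q.2))) ?_ ?_
    · refine continuous_fst.continuousOn.prodMk (e.symm.continuousOn.comp ?_ (fun _ h => h))
      exact (((ContMDiffMap.contMDiff f).continuous.comp continuous_fst).prodMk
        continuous_snd).continuousOn
    · intro q (hq : (f q.1, q.2) ∈ e.target)
      simp [hq]

theorem pullChart_symm_fst (e : OpenPartialHomeomorph Y (X × F)) (he : IsProductChart π F e)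
    (p₀ : FibProdSet f π) (q : N × F) (hq : q ∈ (pullChart f π e he p₀).target) :
    ((pullChart f π e he p₀).symm q).1 = (q.1, e.symm (f q.1, q.2)) := by
  have hq' : (f q.1, q.2) ∈ e.target := hq
  simp [pullChart, hq']

/-- A fibre product along a submersion with factor `F` is locally `N × F`. -/
abbrev fibProdCharted (h : IsSubm π F) : ChartedSpace (N × F) (FibProdSet f π) where
  atlas := {c | ∃ e, ∃ he : IsProductChart π F e, ∃ p₀, c = pullChart f π e he p₀}
  chartAt p := pullChart f π (h p.1.2).choose (h p.1.2).choose_spec.1 p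
  mem_chart_source p := (h p.1.2).choose_spec.2
  chart_mem_atlas _ := ⟨_, _, _, rfl⟩

theorem pullChart_transition (e e' : OpenPartialHomeomorph Y (X × F))
    (he : IsProductChart π F e) (he' : IsProductChart π F e') (p₀ p₀' : FibProdSet f π) :
    ContMDiffOn (N.I.prod F.I) (N.I.prod F.I) ∞
      ((pullChart f π e he p₀).symm ≫ₕ pullChart f π e' he' p₀')
      ((pullChart f π e he p₀).symm ≫ₕ pullChart f π e' he' p₀').source := by
  have hsub : ∀ q ∈ ((pullChart f π e he p₀).symm ≫ₕ pullChart f π e' he' p₀').source,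
      (f q.1, q.2) ∈ e.target ∧ e.symm (f q.1, q.2) ∈ e'.source := by
    intro q hq
    rw [OpenPartialHomeomorph.trans_source] at hq
    have h1 : q ∈ (pullChart f π e he p₀).target := hq.1
    refine ⟨h1, ?_⟩
    have h2 : ((pullChart f π e he p₀).symm q).1.2 ∈ e'.source := hq.2
    rwa [pullChart_symm_fst f π e he p₀ q h1] at h2
  have hf : ContMDiff (N.I.prod F.I) (X.I.prod F.I) ∞ (fun q : N × F => (f q.1, q.2)) :=
    ((ContMDiffMap.contMDiff f).comp contMDiff_fst).prodMk contMDiff_snd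
  refine ContMDiffOn.congr
    (f := fun q : N × F => (q.1, (e' (e.symm (f q.1, q.2))).2)) ?_ ?_
  · refine contMDiff_fst.contMDiffOn.prodMk ?_
    refine (contMDiff_snd (I := X.I) (J := F.I) (M := X) (N := F)).comp_contMDiffOn ?_
    have h3 := he.smooth_symm.comp hf.contMDiffOn (fun q hq => (hsub q hq).1)
    exact he'.smooth.comp h3 (fun q hq => (hsub q hq).2)
  · intro q hq
    have h1 := pullChart_symm_fst f π e he p₀ q (hsub q hq).1
    simp only [OpenPartialHomeomorph.coe_trans, Function.comp_apply]
    change (((pullChart f π e he p₀).symm q).1.1, (e' ((pullChart f π e he p₀).symm q).1.2).2) = _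
    rw [h1]

/-- The fibre product `N ×_X Y = {(n, y) | f n = π y}` along a submersion `π`, as a manifold. -/
def FibProd (h : IsSubm π F) : Mfd.{max u u₁, max v z} where
  carrier := FibProdSet f π
  modelSpace := N.modelSpace × F.modelSpace
  chartSpace := ModelProd N.chartSpace F.chartSpace
  I := N.I.prod F.I
  boundaryless := inferInstance
  top := inferInstance
  charted :=
    letI := fibProdCharted f π h
    ChartedSpace.comp (ModelProd N.chartSpace F.chartSpace) (N × F) (FibProdSet f π)
  isManifold := by
    let _ := fibProdCharted f π h
    let _ := ChartedSpace.comp (ModelProd N.chartSpace F.chartSpace) (N × F) (FibProdSet f π)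
    apply isManifold_of_contDiffOn
    rintro _ _ ⟨_, ⟨e, he, p₀, rfl⟩, a, ha, rfl⟩ ⟨_, ⟨e', he', p₀', rfl⟩, a', ha', rfl⟩
    rw [← contMDiffOn_iff_contDiffOn]
    have hτ := pullChart_transition f π e e' he he' p₀ p₀'
    have h1 := contMDiffOn_of_mem_maximalAtlas (I := N.I.prod F.I) (n := ∞)
      (IsManifold.subset_maximalAtlas ha')
    have h2 := contMDiffOn_symm_of_mem_maximalAtlas (I := N.I.prod F.I) (n := ∞)
      (IsManifold.subset_maximalAtlas ha)
    refine (N.I.prod F.I).contMDiff.comp_contMDiffOn ?_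
    have h0 : ContMDiffOn 𝓘(ℝ, N.modelSpace × F.modelSpace) (N.I.prod F.I) ∞
        (N.I.prod F.I).symm ((N.I.prod F.I).symm ⁻¹' (((pullChart f π e he p₀ ≫ₕ a).symm ≫ₕ
        (pullChart f π e' he' p₀' ≫ₕ a')).source) ∩ Set.range (N.I.prod F.I)) :=
      (N.I.prod F.I).contMDiffOn_symm.mono Set.inter_subset_right
    have h3 := h2.comp h0 (fun x hx => hx.1.1.1)
    have h4 := hτ.comp h3 (fun x hx => ⟨hx.1.1.2, hx.1.2.1⟩)
    exact h1.comp h4 (fun x hx => hx.1.2.2)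

variable (h : IsSubm π F)

theorem pullChart_smooth (e : OpenPartialHomeomorph Y (X × F)) (he : IsProductChart π F e)
    (p₀ : FibProdSet f π) :
    ContMDiffOn (FibProd f π h).I (N.I.prod F.I) ∞ (M := FibProd f π h)
      (pullChart f π e he p₀) (pullChart f π e he p₀).source ∧
    ContMDiffOn (N.I.prod F.I) (FibProd f π h).I ∞ (M' := FibProd f π h)
      (pullChart f π e he p₀).symm (pullChart f π e he p₀).target := by
  let c₀ : FibProd f π h → OpenPartialHomeomorph (FibProdSet f π) (N × F) := fun p =>
    pullChart f π (h p.1.2).choose (h p.1.2).choose_spec.1 p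
  have hc₀ : ∀ p : FibProd f π h, chartAt (FibProd f π h).chartSpace p =
      c₀ p ≫ₕ chartAt (ModelProd N.chartSpace F.chartSpace) (c₀ p p) := fun p => rfl
  have key : ∀ p : FibProd f π h,
      ContMDiffOn (FibProd f π h).I (N.I.prod F.I) ∞ (M := FibProd f π h)
        (c₀ p) ((chartAt (FibProd f π h).chartSpace p).source) ∧
      ContMDiffOn (N.I.prod F.I) (FibProd f π h).I ∞ (M' := FibProd f π h)
        (c₀ p).symm ((c₀ p).target ∩
          (chartAt (ModelProd N.chartSpace F.chartSpace) (c₀ p p)).source) := by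
    intro p
    have h1 := contMDiffOn_chart (I := (FibProd f π h).I) (n := ∞) (x := p)
    have h2 := contMDiffOn_chart_symm (I := (FibProd f π h).I) (n := ∞) (x := p)
    have h3 := contMDiffOn_chart (I := N.I.prod F.I) (n := ∞) (x := c₀ p p)
    have h4 := contMDiffOn_chart_symm (I := N.I.prod F.I) (n := ∞) (x := c₀ p p)
    constructor
    · refine (h4.comp h1 (fun x hx => (chartAt _ p).map_source hx |>.1)).congr ?_
      intro x hx
      exact ((chartAt (ModelProd N.chartSpace F.chartSpace) (c₀ p p)).left_inv hx.2).symm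
    · refine (h2.comp (h3.mono Set.inter_subset_right) ?_).congr ?_
      · intro x hx
        refine ⟨(chartAt (ModelProd N.chartSpace F.chartSpace) (c₀ p p)).map_source hx.2, ?_⟩
        change (chartAt (ModelProd N.chartSpace F.chartSpace) (c₀ p p)).symm
          (chartAt (ModelProd N.chartSpace F.chartSpace) (c₀ p p) x) ∈ (c₀ p).target
        rw [(chartAt (ModelProd N.chartSpace F.chartSpace) (c₀ p p)).left_inv hx.2]
        exact hx.1
      · intro x hx
        change _ = (c₀ p).symm ((chartAt (ModelProd N.chartSpace F.chartSpace) (c₀ p p)).symm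
          (chartAt (ModelProd N.chartSpace F.chartSpace) (c₀ p p) x))
        rw [(chartAt (ModelProd N.chartSpace F.chartSpace) (c₀ p p)).left_inv hx.2]
  have hmem : ∀ p : FibProd f π h, p ∈ (c₀ p).source := fun p => (h p.1.2).choose_spec.2
  constructor
  · intro p hp
    apply ContMDiffAt.contMDiffWithinAt
    have hτ := pullChart_transition f π _ e (h p.1.2).choose_spec.1 he p p₀
    have hp' : c₀ p p ∈ ((c₀ p).symm ≫ₕ pullChart f π e he p₀).source := by
      refine ⟨(c₀ p).map_source (hmem p), ?_⟩
      change (c₀ p).symm (c₀ p p) ∈ (pullChart f π e he p₀).source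
      rwa [(c₀ p).left_inv (hmem p)]
    have h1 := hτ.contMDiffAt (IsOpen.mem_nhds
      ((c₀ p).symm ≫ₕ pullChart f π e he p₀).open_source hp')
    have h2 := (key p).1.contMDiffAt (IsOpen.mem_nhds
      (chartAt (FibProd f π h).chartSpace p).open_source (mem_chart_source _ p))
    refine (h1.comp p h2).congr_of_eventuallyEq ?_
    filter_upwards [IsOpen.mem_nhds (c₀ p).open_source (hmem p)] with x hx
    change _ = pullChart f π e he p₀ ((c₀ p).symm (c₀ p x))
    rw [(c₀ p).left_inv hx]
  · intro q hq
    apply ContMDiffAt.contMDiffWithinAt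
    obtain ⟨p, hp⟩ : ∃ p : FibProd f π h, p = (pullChart f π e he p₀).symm q := ⟨_, rfl⟩
    have hτ := pullChart_transition f π e _ he (h p.1.2).choose_spec.1 p₀ p
    have hq' : q ∈ ((pullChart f π e he p₀).symm ≫ₕ c₀ p).source := by
      refine ⟨hq, ?_⟩
      change (pullChart f π e he p₀).symm q ∈ (c₀ p).source
      rw [← hp]
      exact hmem p
    have h1 := hτ.contMDiffAt (IsOpen.mem_nhds
      ((pullChart f π e he p₀).symm ≫ₕ c₀ p).open_source hq')
    have hval : ((pullChart f π e he p₀).symm ≫ₕ c₀ p) q = c₀ p p := by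
      rw [hp]; rfl
    have h2 : ContMDiffAt (N.I.prod F.I) (FibProd f π h).I ∞ (M' := FibProd f π h)
        (c₀ p).symm (((pullChart f π e he p₀).symm ≫ₕ c₀ p) q) := by
      refine (key p).2.contMDiffAt (IsOpen.mem_nhds
        ((c₀ p).open_target.inter (chartAt _ (c₀ p p)).open_source) ?_)
      rw [hval]
      exact ⟨(c₀ p).map_source (hmem p), mem_chart_source _ _⟩
    refine (h2.comp q h1).congr_of_eventuallyEq ?_
    filter_upwards [IsOpen.mem_nhds
      ((pullChart f π e he p₀).symm ≫ₕ c₀ p).open_source hq'] with x hx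
    change _ = (c₀ p).symm (c₀ p ((pullChart f π e he p₀).symm x))
    exact ((c₀ p).left_inv hx.2).symm

theorem FibProd.contMDiff_fst : ContMDiff (FibProd f π h).I N.I ∞
    (fun p : FibProd f π h => p.1.1) := by
  intro p
  obtain ⟨e, he, hp⟩ := h p.1.2
  have h1 := (pullChart_smooth f π h e he p).1.contMDiffAt
    (IsOpen.mem_nhds (pullChart f π e he p).open_source hp)
  have h2 : ContMDiffAt (N.I.prod F.I) N.I ∞ (Prod.fst : N × F → N) (pullChart f π e he p p) :=
    _root_.contMDiff_fst.contMDiffAt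
  exact h2.comp p h1

theorem FibProd.contMDiff_snd : ContMDiff (FibProd f π h).I Y.I ∞
    (fun p : FibProd f π h => p.1.2) := by
  intro p
  obtain ⟨e, he, hp⟩ := h p.1.2
  have h1 := (pullChart_smooth f π h e he p).1.contMDiffAt
    (IsOpen.mem_nhds (pullChart f π e he p).open_source hp)
  have hf : ContMDiff (N.I.prod F.I) (X.I.prod F.I) ∞ (fun q : N × F => (f q.1, q.2)) :=
    ((ContMDiffMap.contMDiff f).comp _root_.contMDiff_fst).prodMk _root_.contMDiff_snd
  have hpair : ∀ x : FibProd f π h, x.1.2 ∈ e.source → (f x.1.1, (e x.1.2).2) = e x.1.2 :=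
    fun x hx => Prod.ext (x.2.trans (he.fst_eq _ hx).symm) rfl
  have h2 : ContMDiffAt (X.I.prod F.I) Y.I ∞ e.symm (f p.1.1, (e p.1.2).2) := by
    refine he.smooth_symm.contMDiffAt (IsOpen.mem_nhds e.open_target ?_)
    rw [hpair p hp]
    exact e.map_source hp
  have h3 := ContMDiffAt.comp p h2 (ContMDiffAt.comp p hf.contMDiffAt h1)
  refine h3.congr_of_eventuallyEq ?_
  filter_upwards [IsOpen.mem_nhds (pullChart f π e he p).open_source hp] with x hx
  change x.1.2 = e.symm (f x.1.1, (e x.1.2).2)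
  rw [hpair x hx]
  exact (e.left_inv hx).symm

theorem FibProd.contMDiff_lift {M : Mfd.{u₃, v₃}} (a : M.Hom N) (b : M.Hom Y)
    (hab : ∀ x, f (a x) = π (b x)) :
    ContMDiff M.I (FibProd f π h).I ∞ (M' := FibProd f π h) (fun x => ⟨(a x, b x), hab x⟩) := by
  intro x
  obtain ⟨e, he, hx⟩ := h (b x)
  let p : FibProd f π h := ⟨(a x, b x), hab x⟩
  have h2 := (pullChart_smooth f π h e he p).2.contMDiffAt (x := pullChart f π e he p p)
    (IsOpen.mem_nhds (pullChart f π e he p).open_target ((pullChart f π e he p).map_source hx))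
  have h4 : ContMDiffAt M.I (X.I.prod F.I) ∞ (fun x => e (b x)) x :=
    (he.smooth.contMDiffAt (IsOpen.mem_nhds e.open_source hx)).comp x
      (ContMDiffMap.contMDiff b).contMDiffAt
  have h5 : ContMDiffAt M.I F.I ∞ (fun x => (e (b x)).2) x :=
    ContMDiffAt.comp x (_root_.contMDiff_snd (I := X.I) (J := F.I) (M := X) (N := F)).contMDiffAt h4
  have h1 : ContMDiffAt M.I (N.I.prod F.I) ∞ (fun x => (a x, (e (b x)).2)) x :=
    (ContMDiffMap.contMDiff a).contMDiffAt.prodMk h5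
  refine (ContMDiffAt.comp x h2 h1).congr_of_eventuallyEq ?_
  have hb : ContinuousAt b x := (ContMDiffMap.contMDiff b).continuous.continuousAt
  filter_upwards [hb.preimage_mem_nhds (IsOpen.mem_nhds e.open_source hx)] with x' hx'
  let p' : FibProd f π h := ⟨(a x', b x'), hab x'⟩
  exact ((pullChart f π e he p).left_inv (x := p') hx').symm

/-- The projection `N ×_X Y → N`. -/
def FibProd.fst : (FibProd f π h).Hom N := ⟨fun p => p.1.1, FibProd.contMDiff_fst f π h⟩

/-- The projection `N ×_X Y → Y`. -/
def FibProd.snd : (FibProd f π h).Hom Y := ⟨fun p => p.1.2, FibProd.contMDiff_snd f π h⟩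

/-- The map into a fibre product with given components. -/
def FibProd.lift {M : Mfd.{u₃, v₃}} (a : M.Hom N) (b : M.Hom Y) (hab : ∀ x, f (a x) = π (b x)) :
    M.Hom (FibProd f π h) :=
  ⟨fun x => ⟨(a x, b x), hab x⟩, FibProd.contMDiff_lift f π h a b hab⟩

theorem FibProd.isSubm_fst : IsSubm (FibProd.fst f π h) F := by
  intro p
  obtain ⟨e, he, hp⟩ := h p.1.2
  exact ⟨pullChart f π e he p, ⟨fun _ _ => rfl, (pullChart_smooth f π h e he p).1,
    (pullChart_smooth f π h e he p).2⟩, hp⟩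

end FibProd

theorem IsSubm.comp {Z : Mfd.{u₃, v₃}} {Y : Mfd.{u₁, v₁}} {X : Mfd.{u₂, v₂}} {F : Mfd.{w, z}}
    {F' : Mfd.{u, v}} {π : Y.Hom X} {ρ : Z.Hom Y} (hπ : IsSubm π F) (hρ : IsSubm ρ F') :
    IsSubm (π.comp ρ) (F.prod F') := by
  intro x
  obtain ⟨e, he, hx⟩ := hρ x
  obtain ⟨e', he', hx'⟩ := hπ (ρ x)
  let A : OpenPartialHomeomorph (Y × F') ((X × F) × F') :=
    e'.prod (OpenPartialHomeomorph.refl F')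
  let B : OpenPartialHomeomorph ((X × F) × F') (X × (F.prod F')) :=
    (Homeomorph.prodAssoc X F F').toOpenPartialHomeomorph
  have hA : ContMDiffOn (Y.I.prod F'.I) ((X.I.prod F.I).prod F'.I) ∞ A A.source := by
    refine ContMDiffOn.prodMk ?_ contMDiff_snd.contMDiffOn
    exact he'.smooth.comp contMDiff_fst.contMDiffOn (fun q hq => hq.1)
  have hA' : ContMDiffOn ((X.I.prod F.I).prod F'.I) (Y.I.prod F'.I) ∞ A.symm A.target := by
    refine ContMDiffOn.prodMk ?_ contMDiff_snd.contMDiffOn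
    exact he'.smooth_symm.comp contMDiff_fst.contMDiffOn (fun q hq => hq.1)
  have hB : ContMDiff ((X.I.prod F.I).prod F'.I) (X.I.prod (F.prod F').I) ∞ B :=
    (contMDiff_fst.comp contMDiff_fst).prodMk
      ((contMDiff_snd.comp contMDiff_fst).prodMk contMDiff_snd)
  have hB' : ContMDiff (X.I.prod (F.prod F').I) ((X.I.prod F.I).prod F'.I) ∞ B.symm :=
    (contMDiff_fst.prodMk (contMDiff_fst.comp contMDiff_snd)).prodMk
      (contMDiff_snd.comp contMDiff_snd)
  have hfst : ∀ y ∈ e.source, (e y).1 = ρ y := he.fst_eq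
  refine ⟨(e ≫ₕ A) ≫ₕ B, ⟨?_, ?_, ?_⟩, ?_⟩
  · intro y hy
    have h1 : y ∈ e.source := hy.1.1
    have h2 : (e y).1 ∈ e'.source := hy.1.2.1
    change (e' (e y).1).1 = π (ρ y)
    rw [he'.fst_eq _ h2, hfst y h1]
  · exact hB.comp_contMDiffOn (hA.comp (he.smooth.mono fun y hy => hy.1.1) fun y hy => hy.1.2)
  · exact he.smooth_symm.comp (hA'.comp hB'.contMDiffOn fun y hy => hy.2.1) fun y hy => hy.2.2
  · refine ⟨⟨hx, ?_, trivial⟩, trivial⟩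
    change (e x).1 ∈ e'.source
    rw [hfst x hx]
    exact hx'

/-- A (Banach) Lie group. -/
structure LieGrp extends Mfd.{u, v} where
  [group : Group carrier]
  [lieGroup : LieGroup I ∞ carrier]
  [complete : CompleteSpace modelSpace]

namespace LieGrp

instance : CoeSort LieGrp.{u, v} (Type u) := ⟨fun G => G.carrier⟩

attribute [instance] group lieGroup complete

variable (G : LieGrp.{u, v})

instance : LieGroup G.I (minSmoothness ℝ 3) G := LieGroup.of_le (n := ∞) (by simp; norm_cast)

/-- The Lie algebra of `G`: the tangent space at the identity. As for all tangent spaces in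
Mathlib, the underlying normed space is the model space of `G`. -/
def Lie : Type v := G.modelSpace

instance : NormedAddCommGroup G.Lie := inferInstanceAs (NormedAddCommGroup G.modelSpace)

instance : NormedSpace ℝ G.Lie := inferInstanceAs (NormedSpace ℝ G.modelSpace)

/-- The Lie bracket of `G.Lie`, computed with left-invariant vector fields. -/
def bracket : G.Lie →ₗ[ℝ] G.Lie →ₗ[ℝ] G.Lie :=
  LinearMap.mk₂ ℝ (M := GroupLieAlgebra G.I G) (Nₗ := GroupLieAlgebra G.I G)
    (Pₗ := GroupLieAlgebra G.I G) (fun x y => ⁅x, y⁆)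
    (fun x y z => add_lie (L := GroupLieAlgebra G.I G) (M := GroupLieAlgebra G.I G) x y z)
    (fun c x y => smul_lie (L := GroupLieAlgebra G.I G) (M := GroupLieAlgebra G.I G) c x y)
    (fun x y z => lie_add (L := GroupLieAlgebra G.I G) (M := GroupLieAlgebra G.I G) x y z)
    (fun c x y => lie_smul (L := GroupLieAlgebra G.I G) (M := GroupLieAlgebra G.I G) c x y)

theorem bracket_self (x : G.Lie) : G.bracket x x = 0 :=
  lie_self (L := GroupLieAlgebra G.I G) x

variable {G}

theorem contMDiff_conj (g : G) : ContMDiff G.I G.I ∞ (fun x : G => g * x * g⁻¹) :=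
  (contMDiff_const.mul contMDiff_id).mul contMDiff_const

/-- The adjoint action of `g` on the Lie algebra: the derivative at `1` of `x ↦ g x g⁻¹`. -/
def adjoint (g : G) : G.Lie →L[ℝ] G.Lie := mfderiv G.I G.I (fun x : G => g * x * g⁻¹) 1

theorem adjoint_one : adjoint (1 : G) = ContinuousLinearMap.id ℝ G.Lie := by
  have : (fun x : G => 1 * x * 1⁻¹) = id := by ext; simp
  unfold adjoint
  rw [this, mfderiv_id]
  rfl

theorem adjoint_mul (g h : G) : adjoint (g * h) = (adjoint g).comp (adjoint h) := by
  have h0 : (fun x : G => g * h * x * (g * h)⁻¹) =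
      (fun x : G => g * x * g⁻¹) ∘ (fun x : G => h * x * h⁻¹) := by
    ext; simp [mul_assoc]
  have h1 := mfderiv_comp (I := G.I) (I' := G.I) (I'' := G.I) (1 : G)
    ((contMDiff_conj g).mdifferentiable (by simp) (h * 1 * h⁻¹))
    ((contMDiff_conj h).mdifferentiable (by simp) 1)
  rw [← h0] at h1
  have h2 : h * 1 * h⁻¹ = 1 := by simp
  unfold adjoint
  refine h1.trans ?_
  have : ∀ k : G, k = 1 → (mfderiv G.I G.I (fun x : G => g * x * g⁻¹) k :
      G.modelSpace →L[ℝ] G.modelSpace) = mfderiv G.I G.I (fun x : G => g * x * g⁻¹) 1 := by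
    rintro k rfl; rfl
  exact congrArg (fun T : G.modelSpace →L[ℝ] G.modelSpace =>
    T.comp (mfderiv G.I G.I (fun x : G => h * x * h⁻¹) 1 : G.modelSpace →L[ℝ] G.modelSpace))
    (this _ h2)

variable (G) in
/-- The adjoint representation. -/
def Ad : G →* (G.Lie →L[ℝ] G.Lie) where
  toFun := adjoint
  map_one' := adjoint_one
  map_mul' := adjoint_mul

/-- The (left) Maurer–Cartan form. -/
def maurerCartan (g : G) : TangentSpace G.I g →L[ℝ] G.Lie :=
  mfderiv G.I G.I (fun x : G => g⁻¹ * x) g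

/-- The circle group `𝕋`; its Lie algebra is (a copy of) `iℝ`. -/
def circle : LieGrp.{0, 0} where
  carrier := Circle
  modelSpace := EuclideanSpace ℝ (Fin 1)
  chartSpace := EuclideanSpace ℝ (Fin 1)
  I := 𝓡 1
  isManifold := inferInstance
  lieGroup := inferInstance

end LieGrp

/-- A smooth principal `G`-bundle (with right action) over `X`. -/
structure PrincipalBundle (G : LieGrp.{w, z}) (X : Mfd.{u, v}) where
  tot : Mfd.{u, max v z}
  proj : tot.Hom X
  act : tot → G → tot
  act_smooth : ContMDiff (tot.I.prod G.I) tot.I ∞ (fun p : tot × G => act p.1 p.2)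
  act_one : ∀ b, act b 1 = b
  act_mul : ∀ b g h, act b (g * h) = act (act b g) h
  proj_act : ∀ b g, proj (act b g) = proj b
  locTriv : ∀ x : X, ∃ e : Trivialization G proj, x ∈ e.baseSet ∧
    ContMDiffOn tot.I (X.I.prod G.I) ∞ e e.source ∧
    ContMDiffOn (X.I.prod G.I) tot.I ∞ e.toOpenPartialHomeomorph.symm e.target ∧
    ∀ b ∈ e.source, ∀ g, e (act b g) = ((e b).1, (e b).2 * g)

namespace PrincipalBundle

variable {G : LieGrp.{w, z}} {X : Mfd.{u, v}} (B : PrincipalBundle G X)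

theorem isSubm : IsSubm B.proj G.toMfd := by
  intro b
  obtain ⟨e, hx, h1, h2, -⟩ := B.locTriv (B.proj b)
  exact ⟨e.toOpenPartialHomeomorph, ⟨fun y hy => e.coe_fst hy, h1, h2⟩, e.mem_source.2 hx⟩

theorem proj_surjective : Function.Surjective B.proj := by
  intro x
  obtain ⟨e, hx, -⟩ := B.locTriv x
  exact ⟨e.toOpenPartialHomeomorph.symm (x, 1), e.proj_symm_apply (e.mem_target.2 hx)⟩

theorem existsUnique_div (b₁ b₂ : B.tot) (h : B.proj b₁ = B.proj b₂) :
    ∃! g : G, B.act b₁ g = b₂ := by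
  obtain ⟨e, hx, -, -, he⟩ := B.locTriv (B.proj b₁)
  have hb₁ : b₁ ∈ e.source := e.mem_source.2 hx
  have hb₂ : b₂ ∈ e.source := e.mem_source.2 (h ▸ hx)
  have hact : ∀ g, B.act b₁ g ∈ e.source := fun g => e.mem_source.2 (by rwa [B.proj_act])
  refine ⟨(e b₁).2⁻¹ * (e b₂).2, ?_, ?_⟩
  · apply e.injOn (hact _) hb₂
    change e _ = e _
    rw [he _ hb₁]
    refine Prod.ext ?_ ?_
    · change (e b₁).1 = (e b₂).1
      rw [e.coe_fst hb₁, e.coe_fst hb₂, h]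
    · simp
  · rintro g rfl
    rw [he _ hb₁]
    simp

/-- The fibre product `B ×_X B`, written `B^[2]`. -/
abbrev sq : Mfd.{u, max v z} := FibProd B.proj B.proj B.isSubm

/-- The underlying function of `ζ`: `ζ (b₁, b₂)` is the element of `G` with `b₁ ζ(b₁, b₂) = b₂`. -/
def div (p : B.sq) : G := (B.existsUnique_div p.1.1 p.1.2 p.2).choose

theorem act_div (p : B.sq) : B.act p.1.1 (B.div p) = p.1.2 :=
  (B.existsUnique_div p.1.1 p.1.2 p.2).choose_spec.1

theorem div_eq (p : B.sq) (g : G) (hg : B.act p.1.1 g = p.1.2) : B.div p = g :=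
  ((B.existsUnique_div p.1.1 p.1.2 p.2).choose_spec.2 g hg).symm

theorem contMDiff_div : ContMDiff B.sq.I G.I ∞ B.div := by
  intro p
  obtain ⟨e, hx, h1, -, he⟩ := B.locTriv (B.proj p.1.1)
  have hp₁ : p.1.1 ∈ e.source := e.mem_source.2 hx
  have hp₂ : p.1.2 ∈ e.source := e.mem_source.2 (p.2 ▸ hx)
  have hs := e.open_source
  have hfst := FibProd.contMDiff_fst B.proj B.proj B.isSubm
  have hsnd := FibProd.contMDiff_snd B.proj B.proj B.isSubm
  have a1 : ContMDiffAt B.sq.I (X.I.prod G.I) ∞ (fun q : B.sq => e q.1.1) p :=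
    (h1.contMDiffAt (hs.mem_nhds hp₁)).comp p hfst.contMDiffAt
  have a2 : ContMDiffAt B.sq.I (X.I.prod G.I) ∞ (fun q : B.sq => e q.1.2) p :=
    (h1.contMDiffAt (hs.mem_nhds hp₂)).comp p hsnd.contMDiffAt
  have a3 : ContMDiffAt B.sq.I G.I ∞ (fun q : B.sq => (e q.1.1).2⁻¹ * (e q.1.2).2) p :=
    a1.snd.inv.mul a2.snd
  refine a3.congr_of_eventuallyEq ?_
  filter_upwards [hfst.continuous.continuousAt.preimage_mem_nhds (hs.mem_nhds hp₁)] with q hq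
  have hq' : q.1.1 ∈ e.source := hq
  have h := he _ hq' (B.div q)
  rw [B.act_div] at h
  rw [h]
  simp

/-- The map `ζ : B^[2] → G`, `b₁ ζ(b₁, b₂) = b₂`. -/
def zeta : B.sq.Hom G.toMfd := ⟨B.div, B.contMDiff_div⟩

variable {N : Mfd.{u, v₁}}

/-- The pull-back bundle `f^*B = {(n, b) | f n = π b}`. -/
def pullback (f : N.Hom X) : PrincipalBundle G N where
  tot := FibProd f B.proj B.isSubm
  proj := FibProd.fst f B.proj B.isSubm
  act p g := ⟨(p.1.1, B.act p.1.2 g), p.2.trans (B.proj_act _ _).symm⟩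
  act_smooth := FibProd.contMDiff_lift f B.proj B.isSubm
    (M := (FibProd f B.proj B.isSubm).prod G.toMfd)
    ⟨fun p => p.1.1.1, (FibProd.contMDiff_fst f B.proj B.isSubm).comp contMDiff_fst⟩
    ⟨fun p => B.act p.1.1.2 p.2, B.act_smooth.comp
      (((FibProd.contMDiff_snd f B.proj B.isSubm).comp contMDiff_fst).prodMk contMDiff_snd)⟩
    (fun p => p.1.2.trans (B.proj_act _ _).symm)
  act_one p := Subtype.ext (Prod.ext rfl (B.act_one _))
  act_mul p g h := Subtype.ext (Prod.ext rfl (B.act_mul _ _ _))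
  proj_act _ _ := rfl
  locTriv n := by
    obtain ⟨e, hx, h1, h2, he⟩ := B.locTriv (f n)
    have hc : IsProductChart B.proj G.toMfd e.toOpenPartialHomeomorph :=
      ⟨fun y hy => e.coe_fst hy, h1, h2⟩
    let p₀ : FibProdSet f B.proj := ⟨(n, e.toOpenPartialHomeomorph.symm (f n, 1)),
      (e.proj_symm_apply (x := (f n, 1)) (e.mem_target.2 hx)).symm⟩
    have hs := pullChart_smooth f B.proj B.isSubm e.toOpenPartialHomeomorph hc p₀
    let e' : Trivialization G (FibProd.fst f B.proj B.isSubm) :=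
      { toOpenPartialHomeomorph := pullChart f B.proj e.toOpenPartialHomeomorph hc p₀
        baseSet := f ⁻¹' e.baseSet
        open_baseSet := e.open_baseSet.preimage (ContMDiffMap.contMDiff f).continuous
        source_eq := by
          ext p
          change p.1.2 ∈ e.source ↔ f p.1.1 ∈ e.baseSet
          rw [e.mem_source, p.2]
        target_eq := by
          ext q
          change (f q.1, q.2) ∈ e.target ↔ _
          rw [e.mem_target]
          simp
        proj_toFun := fun p _ => rfl }
    refine ⟨e', hx, hs.1, hs.2, ?_⟩
    intro p hp g
    have h3 : e (B.act p.1.2 g) = ((e p.1.2).1, (e p.1.2).2 * g) := he p.1.2 hp g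
    have h4 : (e (B.act p.1.2 g)).2 = (e p.1.2).2 * g := by rw [h3]
    exact Prod.ext rfl h4

/-- The bundle map `f^*B → B` covering `f`. -/
def pullbackMap (f : N.Hom X) : (B.pullback f).tot.Hom B.tot := FibProd.snd f B.proj B.isSubm

end PrincipalBundle
/-- A central extension `1 → 𝕋 → Γh → Γ → 1` of Lie groups; as usual this includes that
`q : Γh → Γ` is a (locally trivial) principal `𝕋`-bundle. -/
structure CentralExtension (Γ Γh : LieGrp.{u, v}) where
  ι : LieGrp.circle →* Γh
  q : Γh →* Γ
  smooth_ι : ContMDiff LieGrp.circle.I Γh.I ∞ ι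
  smooth_q : ContMDiff Γh.I Γ.I ∞ q
  injective_ι : Function.Injective ι
  surjective_q : Function.Surjective q
  exact : ∀ x, q x = 1 ↔ ∃ t, ι t = x
  central : ∀ t x, ι t * x = x * ι t
  locTriv : ∀ y : Γ, ∃ e : Trivialization LieGrp.circle q, y ∈ e.baseSet ∧
    ContMDiffOn Γh.I (Γ.I.prod LieGrp.circle.I) ∞ e e.source ∧
    ContMDiffOn (Γ.I.prod LieGrp.circle.I) Γh.I ∞ e.toOpenPartialHomeomorph.symm e.target ∧
    ∀ x ∈ e.source, ∀ t, e (x * ι t) = ((e x).1, (e x).2 * t)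

namespace CentralExtension

variable {Γ Γh : LieGrp.{u, v}} (E : CentralExtension Γ Γh)

/-- `q : Γh → Γ` as a smooth map. -/
def qHom : Γh.toMfd.Hom Γ.toMfd := ⟨E.q, E.smooth_q⟩

theorem q_ι (t : LieGrp.circle) : E.q (E.ι t) = 1 := (E.exact _).2 ⟨t, rfl⟩

/-- `q : Γh → Γ` as a principal `𝕋`-bundle. -/
def bundle : PrincipalBundle LieGrp.circle Γ.toMfd where
  tot := Γh.toMfd
  proj := E.qHom
  act x t := x * E.ι t
  act_smooth := contMDiff_fst.mul (E.smooth_ι.comp contMDiff_snd)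
  act_one x := by simp
  act_mul x s t := by simp [mul_assoc]
  proj_act x t := by
    change E.q (x * E.ι t) = E.q x
    rw [map_mul, E.q_ι, mul_one]
  locTriv := E.locTriv

/-- The induced map `ι_* : iℝ → Lie Γh`. -/
def ιLie : LieGrp.circle.Lie →L[ℝ] Γh.Lie := mfderiv LieGrp.circle.I Γh.I E.ι 1

/-- The induced map `q_* : Lie Γh → Lie Γ`. -/
def qLie : Γh.Lie →L[ℝ] Γ.Lie := mfderiv Γh.I Γ.I E.q 1

theorem exists_toCenter : ∃ r : Γh.Lie →L[ℝ] LieGrp.circle.Lie,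
    r.comp E.ιLie = ContinuousLinearMap.id ℝ LieGrp.circle.Lie := by
  obtain ⟨e, hx, h1, -, he⟩ := E.locTriv 1
  have h1s : (1 : Γh) ∈ e.source := e.mem_source.2 (by rwa [map_one])
  let c := (e (1 : Γh)).2
  let p : Γh → LieGrp.circle := fun x => c⁻¹ * (e x).2
  have hp : MDifferentiableAt Γh.I LieGrp.circle.I p (E.ι 1) := by
    rw [map_one]
    have := (h1.contMDiffAt (e.open_source.mem_nhds h1s)).snd
    exact (contMDiffAt_const.mul this).mdifferentiableAt (by simp)
  have hι : MDifferentiableAt LieGrp.circle.I Γh.I E.ι 1 :=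
    E.smooth_ι.mdifferentiable (by simp) 1
  refine ⟨(mfderiv Γh.I LieGrp.circle.I p (E.ι 1) :
    Γh.modelSpace →L[ℝ] LieGrp.circle.modelSpace), ?_⟩
  have hcomp : p ∘ E.ι = id := by
    ext1 t
    have := he 1 h1s t
    rw [one_mul] at this
    change c⁻¹ * (e (E.ι t)).2 = t
    rw [this]
    simp [c]
  have h2 := mfderiv_comp (I := LieGrp.circle.I) (I' := Γh.I) (I'' := LieGrp.circle.I) 1 hp hι
  rw [hcomp, mfderiv_id] at h2
  exact h2.symm

/-- The inverse of the isomorphism `ι_* : iℝ → ker q_*`. It is the restriction to `ker q_*` of any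
continuous left inverse of `ι_*`, and will be applied to elements of `ker q_*` only. -/
def toCenter : Γh.Lie →L[ℝ] LieGrp.circle.Lie := E.exists_toCenter.choose

theorem toCenter_ιLie (z : LieGrp.circle.Lie) : E.toCenter (E.ιLie z) = z :=
  DFunLike.congr_fun E.exists_toCenter.choose_spec z

theorem Ad_ι (t : LieGrp.circle) : Γh.Ad (E.ι t) = 1 := by
  have : (fun x : Γh => E.ι t * x * (E.ι t)⁻¹) = id := by
    ext x; simp [E.central]
  change LieGrp.adjoint (E.ι t) = _
  unfold LieGrp.adjoint
  rw [this, mfderiv_id]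
  rfl

theorem Ad_eq_of_q_eq {x y : Γh} (h : E.q x = E.q y) : Γh.Ad x = Γh.Ad y := by
  obtain ⟨t, ht⟩ := (E.exact (y⁻¹ * x)).1 (by simp [h])
  have : x = y * E.ι t := by rw [ht]; simp
  rw [this, map_mul, E.Ad_ι, mul_one]

/-- The action of `Γ` on `Lie Γh`: `Ad_γ = Ad_γ̂` for any lift `γ̂` of `γ`. -/
def Ad : Γ →* (Γh.Lie →L[ℝ] Γh.Lie) where
  toFun γ := Γh.Ad (Function.surjInv E.surjective_q γ)
  map_one' := by
    rw [← map_one Γh.Ad]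
    exact E.Ad_eq_of_q_eq (by simp [Function.surjInv_eq])
  map_mul' γ η := by
    rw [← map_mul]
    exact E.Ad_eq_of_q_eq (by simp [Function.surjInv_eq])

theorem Ad_q (x : Γh) : E.Ad (E.q x) = Γh.Ad x :=
  E.Ad_eq_of_q_eq (Function.surjInv_eq _ _)

/-- A (continuous) linear split of `0 → iℝ → Lie Γh → Lie Γ → 0`. -/
structure Split where
  toCLM : Γ.Lie →L[ℝ] Γh.Lie
  qLie_toCLM : ∀ x, E.qLie (toCLM x) = x

variable {E}

/-- The group cocycle `Z_σ(γ, X) = Ad_γ (σ X) - σ (Ad_γ X)`, with values in `iℝ`. -/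
def Split.Z (σ : E.Split) (γ : Γ) : Γ.Lie →L[ℝ] LieGrp.circle.Lie :=
  E.toCenter ∘L (E.Ad γ ∘L σ.toCLM - σ.toCLM ∘L Γ.Ad γ)

/-- The Lie algebra cocycle `ω_σ(X, Y) = [σ X, σ Y] - σ [X, Y]`, with values in `iℝ`. -/
def Split.omega (σ : E.Split) : Γ.Lie →ₗ[ℝ] Γ.Lie →ₗ[ℝ] LieGrp.circle.Lie :=
  ((Γh.bracket.compl₁₂ σ.toCLM.toLinearMap σ.toCLM.toLinearMap) -
    Γ.bracket.compr₂ σ.toCLM.toLinearMap).compr₂ E.toCenter.toLinearMap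

theorem Split.omega_self (σ : E.Split) (x : Γ.Lie) : σ.omega x x = 0 := by
  simp [Split.omega, LieGrp.bracket_self]

/-- The connection `ν_σ = μ̂ - σ (q^* μ)` on the `𝕋`-bundle `q : Γh → Γ`. -/
def Split.nu (σ : E.Split) (x : Γh) : TangentSpace Γh.I x →L[ℝ] LieGrp.circle.Lie :=
  E.toCenter ∘L (LieGrp.maurerCartan x -
    σ.toCLM ∘L (LieGrp.maurerCartan (E.q x) ∘L mfderiv Γh.I Γ.I E.q x))

end CentralExtension

/-- Smooth `V`-valued 1-forms. -/
structure OneForm (M : Mfd.{u, v}) (V : Type w) [NormedAddCommGroup V] [NormedSpace ℝ V] where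
  toFun : ∀ p : M, TangentSpace M.I p →L[ℝ] V
  smooth : ContMDiff M.I.tangent 𝓘(ℝ, V) ∞ (fun p : TangentBundle M.I M => toFun p.1 p.2)

namespace OneForm

variable {M : Mfd.{u, v}} {V : Type w} [NormedAddCommGroup V] [NormedSpace ℝ V]

/-- The coordinate expression of a 1-form in the preferred chart at `p`. -/
def inChart (θ : OneForm M V) (p : M) (x : M.modelSpace) : M.modelSpace →L[ℝ] V :=
  θ.toFun ((extChartAt M.I p).symm x) ∘L
    mfderiv 𝓘(ℝ, M.modelSpace) M.I (extChartAt M.I p).symm x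

/-- The exterior derivative: `dθ (v, w) = ∂_v (θ w) - ∂_w (θ v)` in coordinates. -/
def d (θ : OneForm M V) (p : M) :
    TangentSpace M.I p →L[ℝ] TangentSpace M.I p →L[ℝ] V :=
  let D : M.modelSpace →L[ℝ] M.modelSpace →L[ℝ] V :=
    fderiv ℝ (θ.inChart p) (extChartAt M.I p p)
  let A : M.modelSpace →L[ℝ] M.modelSpace :=
    mfderiv M.I 𝓘(ℝ, M.modelSpace) (extChartAt M.I p) p
  let R : M.modelSpace →L[ℝ] M.modelSpace →L[ℝ] V := (D - D.flip).bilinearComp A A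
  R

theorem d_self (θ : OneForm M V) (p : M) (v : TangentSpace M.I p) : θ.d p v v = 0 :=
  sub_self _

/-- The pull-back of a 1-form. -/
def pullback {N : Mfd.{u₁, v₁}} (f : N.Hom M) (θ : OneForm M V) : OneForm N V where
  toFun p := θ.toFun (f p) ∘L mfderiv N.I M.I f p
  smooth := θ.smooth.comp
    ((ContMDiffMap.contMDiff f).contMDiff_tangentMap (m := ∞) (n := ∞) (by simp))

end OneForm

/-- `V`-valued 2-forms: alternating bilinear maps on the tangent spaces of `M`. -/
@[ext]
structure TwoForm (M : Mfd.{u, v}) (V : Type w) [NormedAddCommGroup V] [NormedSpace ℝ V] where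
  toFun : ∀ p : M, TangentSpace M.I p →ₗ[ℝ] TangentSpace M.I p →ₗ[ℝ] V
  alt : ∀ p v, toFun p v v = 0

/-- The pull-back of a 2-form. -/
def TwoForm.pullback {M : Mfd.{u, v}} {V : Type w} [NormedAddCommGroup V] [NormedSpace ℝ V]
    {N : Mfd.{u₁, v₁}} (f : N.Hom M) (α : TwoForm M V) : TwoForm N V where
  toFun p := (α.toFun (f p)).compl₁₂ (mfderiv N.I M.I f p).toLinearMap
    (mfderiv N.I M.I f p).toLinearMap
  alt _ _ := α.alt _ _

section Associated

variable {G : LieGrp.{w, z}} {X : Mfd.{u, v}} (B : PrincipalBundle G X)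
  {V : Type v₁} [NormedAddCommGroup V] [NormedSpace ℝ V] (ρ : G →* (V →L[ℝ] V))

/-- The relation `(b, v) ∼ (b g, ρ(g⁻¹) v)` on `B × V`. -/
def assocSetoid : Setoid (B.tot × V) where
  r p q := ∃ g : G, q = (B.act p.1 g, ρ g⁻¹ p.2)
  iseqv := by
    refine ⟨fun p => ⟨1, ?_⟩, ?_, ?_⟩
    · simp [B.act_one]
    · rintro p _ ⟨g, rfl⟩
      refine ⟨g⁻¹, Prod.ext ?_ ?_⟩
      · simp [← B.act_mul, B.act_one]
      · change _ = ρ _ (ρ _ p.2)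
        rw [← mul_apply_eq_comp, ← map_mul]
        simp
    · rintro p _ _ ⟨g, rfl⟩ ⟨h, rfl⟩
      refine ⟨g * h, Prod.ext ?_ ?_⟩
      · simp [B.act_mul]
      · change ρ _ (ρ _ p.2) = _
        rw [← mul_apply_eq_comp, ← map_mul, mul_inv_rev]

/-- The associated bundle `B ×_ρ V`, the quotient of `B × V` by `(b, v) ∼ (b g, ρ(g⁻¹) v)`. -/
def Assoc : Type (max u v₁) := Quotient (assocSetoid B ρ)

namespace Assoc

variable {B ρ}

/-- The class `[b, v]`. -/
def mk (b : B.tot) (v : V) : Assoc B ρ := Quotient.mk (assocSetoid B ρ) (b, v)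

theorem ind {P : Assoc B ρ → Prop} (h : ∀ b v, P (mk b v)) (a : Assoc B ρ) : P a :=
  Quotient.ind (fun p => h p.1 p.2) a

theorem mk_eq_mk {b b' : B.tot} {v v' : V} :
    (mk b v : Assoc B ρ) = mk b' v' ↔ ∃ g : G, b' = B.act b g ∧ v' = ρ g⁻¹ v := by
  refine (Quotient.eq (r := assocSetoid B ρ)).trans ?_
  exact exists_congr fun g => Prod.mk_inj

/-- The projection `B ×_ρ V → X`. -/
def proj : Assoc B ρ → X :=
  Quotient.lift (fun p : B.tot × V => B.proj p.1) (by
    rintro p _ ⟨g, rfl⟩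
    exact (B.proj_act _ _).symm)

@[simp] theorem proj_mk (b : B.tot) (v : V) : proj (mk b v : Assoc B ρ) = B.proj b := rfl

/-- If `G` acts trivially on `V` then `B ×_G V = X × V`; this is the second component of that
identification. -/
def coord : Assoc B (1 : G →* (V →L[ℝ] V)) → V :=
  Quotient.lift (fun p : B.tot × V => p.2) (by
    rintro p _ ⟨g, rfl⟩
    rfl)

@[simp] theorem coord_mk (b : B.tot) (v : V) :
    coord (mk b v : Assoc B (1 : G →* (V →L[ℝ] V))) = v := rfl

theorem eq_mk_coord (b : B.tot) (a : Assoc B (1 : G →* (V →L[ℝ] V))) (h : a.proj = B.proj b) :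
    a = mk b a.coord := by
  induction a using ind with
  | h b' v =>
    obtain ⟨g, hg, -⟩ := B.existsUnique_div b' b h
    exact mk_eq_mk.2 ⟨g, hg.symm, rfl⟩

variable {N : Mfd.{u, v₂}}

/-- The canonical map `(f^*B) ×_ρ V → f^*(B ×_ρ V)`, `[(n, b), v] ↦ (n, [b, v])`. -/
def pullbackFun (f : N.Hom X) (a : Assoc (B.pullback f) ρ) :
    {p : N × Assoc B ρ // f p.1 = p.2.proj} :=
  ⟨(a.proj, Quotient.lift (fun p : (B.pullback f).tot × V => (mk p.1.1.2 p.2 : Assoc B ρ)) (by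
    rintro p _ ⟨g, rfl⟩
    exact mk_eq_mk.2 ⟨g, rfl, rfl⟩) a), by
    induction a using ind with
    | h b v => exact b.2⟩

theorem pullbackFun_bijective (f : N.Hom X) :
    Function.Bijective (pullbackFun f : Assoc (B.pullback f) ρ → _) := by
  constructor
  · intro a a' h
    induction a using ind with
    | h b v =>
    induction a' using ind with
    | h b' v' =>
    have h1 : b.1.1 = b'.1.1 := congrArg (fun p => p.1.1) h
    have h2 : (mk b.1.2 v : Assoc B ρ) = mk b'.1.2 v' := congrArg (fun p => p.1.2) h
    obtain ⟨g, hg, hv⟩ := mk_eq_mk.1 h2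
    exact mk_eq_mk.2 ⟨g, Subtype.ext (Prod.ext h1.symm hg), hv⟩
  · rintro ⟨⟨n, a⟩, h⟩
    induction a using ind with
    | h b v => exact ⟨mk (B := B.pullback f) ⟨(n, b), h⟩ v, rfl⟩

/-- The natural isomorphism `(f^*B) ×_ρ V ≅ f^*(B ×_ρ V)`. -/
def pullbackEquiv (f : N.Hom X) :
    Assoc (B.pullback f) ρ ≃ {p : N × Assoc B ρ // f p.1 = p.2.proj} :=
  Equiv.ofBijective _ (pullbackFun_bijective f)

end Assoc

end Associated

section Geometry

variable {Γ Γh : LieGrp.{u, v}} (E : CentralExtension Γ Γh) {X X' : Mfd.{u, v}}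

/-- A connection on a principal bundle: a smooth 1-form with values in the Lie algebra which
reproduces the generators of fundamental vector fields and is equivariant. -/
structure Connection (B : PrincipalBundle Γ X) where
  form : OneForm B.tot Γ.Lie
  fundamental : ∀ (b : B.tot) (x : Γ.Lie),
    form.toFun b (mfderiv Γ.I B.tot.I (fun g : Γ => B.act b g) 1 x) = x
  equivariant : ∀ (b : B.tot) (g : Γ) (v : TangentSpace B.tot.I b),
    form.toFun (B.act b g) (mfderiv B.tot.I B.tot.I (fun b' => B.act b' g) b v) =
      Γ.Ad g⁻¹ (form.toFun b v)

/-- The curvature `F_θ = dθ + ½[θ, θ]`, that is `F_θ(v, w) = dθ(v, w) + [θ v, θ w]`. -/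
def Connection.curvature {B : PrincipalBundle Γ X} (θ : Connection B) : TwoForm B.tot Γ.Lie where
  toFun b := (ContinuousLinearMap.coeLM ℝ) ∘ₗ (θ.form.d b).toLinearMap +
    Γ.bracket.compl₁₂ (θ.form.toFun b).toLinearMap (θ.form.toFun b).toLinearMap
  alt b v := by
    have h1 := θ.form.d_self b v
    have h2 := Γ.bracket_self (θ.form.toFun b v)
    simp [h1, h2]

/-- A splitting of `B`: a map of vector bundles `L : B ×_Ad Lie Γh → B ×_Ad iℝ` over `X` which is
the identity on the subbundle `B ×_Ad iℝ`. (The quotient map `B × Lie Γh → B ×_Ad Lie Γh` is a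
surjective submersion and `B ×_Ad iℝ = X × iℝ`; so smoothness of `L` is smoothness of the iℝ-valued
function `L [b, v]` of `(b, v)`.) -/
structure Splitting (B : PrincipalBundle Γ X) where
  toFun : Assoc B E.Ad → Assoc B (1 : Γ →* (LieGrp.circle.Lie →L[ℝ] LieGrp.circle.Lie))
  proj_toFun : ∀ a, (toFun a).proj = a.proj
  linear : ∀ (b : B.tot) (c : ℝ) (v w : Γh.Lie) (y z : LieGrp.circle.Lie),
    toFun (Assoc.mk b v) = Assoc.mk b y → toFun (Assoc.mk b w) = Assoc.mk b z →
      toFun (Assoc.mk b (c • v + w)) = Assoc.mk b (c • y + z)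
  smooth : ContMDiff (B.tot.I.prod 𝓘(ℝ, Γh.Lie)) 𝓘(ℝ, LieGrp.circle.Lie) ∞
    (fun p : B.tot × Γh.Lie => (toFun (Assoc.mk p.1 p.2)).coord)
  id_on_center : ∀ b y, toFun (Assoc.mk b (E.ιLie y)) = Assoc.mk b y

variable {E}

namespace Splitting

variable {B : PrincipalBundle Γ X} (L : Splitting E B)

theorem toFun_mk (b : B.tot) (v : Γh.Lie) :
    L.toFun (Assoc.mk b v) = Assoc.mk b (L.toFun (Assoc.mk b v)).coord :=
  Assoc.eq_mk_coord b _ (L.proj_toFun _)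

/-- The map `L̄ : B × Lie Γh → iℝ` with `L [b, v] = [b, L̄(b, v)]`. -/
def bar (b : B.tot) : Γh.Lie →ₗ[ℝ] LieGrp.circle.Lie where
  toFun v := (L.toFun (Assoc.mk b v)).coord
  map_add' v w := by
    have := L.linear b 1 v w _ _ (L.toFun_mk b v) (L.toFun_mk b w)
    simp only [one_smul] at this
    rw [this]
    rfl
  map_smul' c v := by
    have h0 : L.toFun (Assoc.mk b 0) = Assoc.mk b 0 := by
      have := L.id_on_center b 0
      rwa [map_zero] at this
    have := L.linear b c v 0 _ _ (L.toFun_mk b v) h0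
    simp only [add_zero] at this
    rw [this]
    rfl

/-- The reduced splitting `ℓ_σ(b, X) = L̄(b, σ X)` induced by `L`. -/
def reduced (σ : E.Split) (b : B.tot) : Γ.Lie →ₗ[ℝ] LieGrp.circle.Lie :=
  L.bar b ∘ₗ σ.toCLM.toLinearMap

end Splitting

/-- The pull-back of a connection: the connection `φ̃^*θ` on `φ^*B`, where `φ̃ : φ^*B → B`. -/
def Connection.pullback {B : PrincipalBundle Γ X} (θ : Connection B) (φ : X'.Hom X) :
    Connection (B.pullback φ) where
  form := θ.form.pullback (B.pullbackMap φ)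
  fundamental p x := by
    let B' := B.pullback φ
    let F : B'.tot.Hom B.tot := B.pullbackMap φ
    have hF : ContMDiff B'.tot.I B.tot.I ∞ F := ContMDiffMap.contMDiff F
    have hact : ContMDiff Γ.I B'.tot.I ∞ (fun g : Γ => B'.act p g) :=
      B'.act_smooth.comp (contMDiff_const.prodMk contMDiff_id)
    have key : ∀ p' : B'.tot, p' = B'.act p 1 →
        ((mfderiv B'.tot.I B.tot.I F p' : B'.tot.modelSpace →L[ℝ] B.tot.modelSpace)
          ((mfderiv Γ.I B'.tot.I (fun g : Γ => B'.act p g) 1 :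
            Γ.modelSpace →L[ℝ] B'.tot.modelSpace) x)) =
        (mfderiv Γ.I B.tot.I (fun g : Γ => B.act (F p) g) 1 :
            Γ.modelSpace →L[ℝ] B.tot.modelSpace) x := by
      rintro _ rfl
      have h := mfderiv_comp (I := Γ.I) (I' := B'.tot.I) (I'' := B.tot.I) (1 : Γ)
        (hF.mdifferentiable (by simp) (B'.act p 1)) (hact.mdifferentiable (by simp) 1)
      exact (DFunLike.congr_fun h x).symm
    have := key p (B'.act_one p).symm
    refine (congrArg (θ.form.toFun (F p)) this).trans ?_
    exact θ.fundamental (F p) x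
  equivariant p g v := by
    let B' := B.pullback φ
    let F : B'.tot.Hom B.tot := B.pullbackMap φ
    have hF : ContMDiff B'.tot.I B.tot.I ∞ F := ContMDiffMap.contMDiff F
    have hact' : ContMDiff B'.tot.I B'.tot.I ∞ (fun p : B'.tot => B'.act p g) :=
      B'.act_smooth.comp (contMDiff_id.prodMk contMDiff_const)
    have hact : ContMDiff B.tot.I B.tot.I ∞ (fun b : B.tot => B.act b g) :=
      B.act_smooth.comp (contMDiff_id.prodMk contMDiff_const)
    have h1 := mfderiv_comp (I := B'.tot.I) (I' := B'.tot.I) (I'' := B.tot.I) p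
      (hF.mdifferentiable (by simp) (B'.act p g)) (hact'.mdifferentiable (by simp) p)
    have h2 := mfderiv_comp (I := B'.tot.I) (I' := B.tot.I) (I'' := B.tot.I) p
      (hact.mdifferentiable (by simp) (F p)) (hF.mdifferentiable (by simp) p)
    have h3 : (F ∘ fun p : B'.tot => B'.act p g) = (fun b : B.tot => B.act b g) ∘ F := rfl
    rw [h3] at h1
    have h4 := DFunLike.congr_fun (h1.symm.trans h2) v
    refine (congrArg (θ.form.toFun (B.act (F p) g)) h4).trans ?_
    exact θ.equivariant (F p) g _

/-- The pull-back `φ^*L` of a splitting, through the natural isomorphisms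
`(φ^*B) ×_Ad Lie Γh ≅ φ^*(B ×_Ad Lie Γh)` and `(φ^*B) ×_Ad iℝ ≅ φ^*(B ×_Ad iℝ)`. -/
def Splitting.pullbackFun {B : PrincipalBundle Γ X} (L : Splitting E B) (φ : X'.Hom X)
    (a : Assoc (B.pullback φ) E.Ad) :
    Assoc (B.pullback φ) (1 : Γ →* (LieGrp.circle.Lie →L[ℝ] LieGrp.circle.Lie)) :=
  (Assoc.pullbackEquiv φ).symm
    ⟨((Assoc.pullbackEquiv φ a).1.1, L.toFun (Assoc.pullbackEquiv φ a).1.2),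
      (Assoc.pullbackEquiv φ a).2.trans (L.proj_toFun _).symm⟩

theorem Splitting.pullbackFun_mk {B : PrincipalBundle Γ X} (L : Splitting E B) (φ : X'.Hom X)
    (p : (B.pullback φ).tot) (v : Γh.Lie) :
    L.pullbackFun φ (Assoc.mk p v) = Assoc.mk p (L.toFun (Assoc.mk p.1.2 v)).coord := by
  unfold Splitting.pullbackFun
  rw [Equiv.symm_apply_eq]
  refine Subtype.ext (Prod.ext rfl ?_)
  exact L.toFun_mk p.1.2 v

theorem Splitting.pullbackFun_mk_eq {B : PrincipalBundle Γ X} (L : Splitting E B) (φ : X'.Hom X)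
    (p : (B.pullback φ).tot) (v : Γh.Lie) (y : LieGrp.circle.Lie) :
    L.pullbackFun φ (Assoc.mk p v) = Assoc.mk p y ↔
      L.toFun (Assoc.mk p.1.2 v) = Assoc.mk p.1.2 y := by
  rw [L.pullbackFun_mk, L.toFun_mk]
  constructor
  · intro h
    rw [show (L.toFun (Assoc.mk p.1.2 v)).coord = y from congrArg Assoc.coord h]
  · exact fun h => congrArg (Assoc.mk p) (congrArg Assoc.coord h)

/-- The pull-back splitting `φ^*L` of `φ^*B`. -/
def Splitting.pullback {B : PrincipalBundle Γ X} (L : Splitting E B) (φ : X'.Hom X) :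
    Splitting E (B.pullback φ) where
  toFun := L.pullbackFun φ
  proj_toFun a := by
    induction a using Assoc.ind with
    | h p v => rw [L.pullbackFun_mk]; rfl
  linear p c v w y z hv hw := by
    rw [L.pullbackFun_mk_eq] at *
    exact L.linear _ _ _ _ _ _ hv hw
  smooth := by
    have h : ContMDiff ((B.pullback φ).tot.I.prod 𝓘(ℝ, Γh.Lie)) (B.tot.I.prod 𝓘(ℝ, Γh.Lie)) ∞
        (fun p : (B.pullback φ).tot × Γh.Lie => (B.pullbackMap φ p.1, p.2)) :=
      ((ContMDiffMap.contMDiff (B.pullbackMap φ)).comp contMDiff_fst).prodMk contMDiff_snd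
    refine (L.smooth.comp h).congr ?_
    intro p
    rw [L.pullbackFun_mk]
    rfl
  id_on_center p y := by
    rw [L.pullbackFun_mk_eq]
    exact L.id_on_center _ _

variable (E) in
/-- A `Γ`-bundle `(B, θ, L)` over `X` with connection and splitting. -/
structure BundleConnSplit (X : Mfd.{u, v}) where
  B : PrincipalBundle Γ X
  θ : Connection B
  L : Splitting E B

/-- The pull-back `φ^*(B, θ, L)`. -/
def BundleConnSplit.pullback (φ : X'.Hom X) (D : BundleConnSplit E X) : BundleConnSplit E X' where
  B := D.B.pullback φ
  θ := D.θ.pullback φ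
  L := D.L.pullback φ

end Geometry

/-- A surjective submersion `π : Y → X` together with a principal `𝕋`-bundle `P` over
`Y^[2] = Y ×_X Y`. -/
structure PreGerbe (X : Mfd.{u, v}) where
  Y : Mfd.{u, v}
  π : Y.Hom X
  surjective : Function.Surjective π
  F : Mfd.{u, v}
  subm : IsSubm π F
  P : PrincipalBundle LieGrp.circle (FibProd π π subm)

namespace PreGerbe

variable {X : Mfd.{u, v}} (𝒢 : PreGerbe X)

/-- `Y^[2]`. -/
abbrev Y2 : Mfd.{u, v} := FibProd 𝒢.π 𝒢.π 𝒢.subm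

/-- The composition of `P → Y^[2]` with the first projection `Y^[2] → Y`. -/
def src : 𝒢.P.tot.Hom 𝒢.Y := (FibProd.fst 𝒢.π 𝒢.π 𝒢.subm).comp 𝒢.P.proj

/-- The composition of `P → Y^[2]` with the second projection `Y^[2] → Y`. -/
def tgt : 𝒢.P.tot.Hom 𝒢.Y := (FibProd.snd 𝒢.π 𝒢.π 𝒢.subm).comp 𝒢.P.proj

theorem src_isSubm : IsSubm 𝒢.src (𝒢.F.prod LieGrp.circle.toMfd) :=
  (FibProd.isSubm_fst 𝒢.π 𝒢.π 𝒢.subm).comp 𝒢.P.isSubm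

theorem π_src (p : 𝒢.P.tot) : 𝒢.π (𝒢.src p) = 𝒢.π (𝒢.tgt p) := (𝒢.P.proj p).2

/-- The manifold of pairs `(p, q)` with `p` over `(y₁, y₂)` and `q` over `(y₂, y₃)`, that is, the
fibre product of `π₁₂^*P` and `π₂₃^*P` over `Y^[3]`. -/
abbrev Comp : Mfd.{u, v} := FibProd 𝒢.tgt 𝒢.src 𝒢.src_isSubm

end PreGerbe

/-- A bundle gerbe. The product `π₁₂^*P ⊗ π₂₃^*P → π₁₃^*P` is given as a smooth `𝕋`-bilinear map
on pairs. -/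
structure BundleGerbe (X : Mfd.{u, v}) extends PreGerbe X where
  mul : toPreGerbe.Comp.Hom P.tot
  src_mul : ∀ c, toPreGerbe.src (mul c) = toPreGerbe.src c.1.1
  tgt_mul : ∀ c, toPreGerbe.tgt (mul c) = toPreGerbe.tgt c.1.2
  mul_act : ∀ (p q : P.tot) (s t : LieGrp.circle) (h : toPreGerbe.tgt p = toPreGerbe.src q)
    (h' : toPreGerbe.tgt (P.act p s) = toPreGerbe.src (P.act q t)),
    mul ⟨(P.act p s, P.act q t), h'⟩ = P.act (mul ⟨(p, q), h⟩) (s * t)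
  assoc : ∀ (p q r : P.tot) (h₁ : toPreGerbe.tgt p = toPreGerbe.src q)
    (h₂ : toPreGerbe.tgt q = toPreGerbe.src r)
    (h₃ : toPreGerbe.tgt (mul ⟨(p, q), h₁⟩) = toPreGerbe.src r)
    (h₄ : toPreGerbe.tgt p = toPreGerbe.src (mul ⟨(q, r), h₂⟩)),
    mul ⟨(mul ⟨(p, q), h₁⟩, r), h₃⟩ = mul ⟨(p, mul ⟨(q, r), h₂⟩), h₄⟩

/-- The data `(P, ∇, f)` underlying a bundle gerbe with connection and curving: a bundle gerbe
`(P, Y)` with an `iℝ`-valued 1-form `∇` on `P` and an `iℝ`-valued 2-form `f` on `Y`. Pull-backs and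
isomorphisms are those of such triples. -/
structure GerbeConnCurv (X : Mfd.{u, v}) extends BundleGerbe X where
  conn : ∀ p : P.tot, TangentSpace P.tot.I p →L[ℝ] LieGrp.circle.Lie
  curving : TwoForm Y LieGrp.circle.Lie

/-- An isomorphism of bundle gerbes over `X`. -/
structure BundleGerbe.Iso {X : Mfd.{u, v}} (𝒢 𝒢' : BundleGerbe X) where
  onY : Diffeomorph 𝒢.Y.I 𝒢'.Y.I 𝒢.Y 𝒢'.Y ∞
  π_onY : ∀ y, 𝒢'.π (onY y) = 𝒢.π y
  onP : Diffeomorph 𝒢.P.tot.I 𝒢'.P.tot.I 𝒢.P.tot 𝒢'.P.tot ∞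
  onP_act : ∀ p t, onP (𝒢.P.act p t) = 𝒢'.P.act (onP p) t
  src_onP : ∀ p, 𝒢'.src (onP p) = onY (𝒢.src p)
  tgt_onP : ∀ p, 𝒢'.tgt (onP p) = onY (𝒢.tgt p)
  onP_mul : ∀ (p q : 𝒢.P.tot) (h : 𝒢.tgt p = 𝒢.src q) (h' : 𝒢'.tgt (onP p) = 𝒢'.src (onP q)),
    onP (𝒢.mul ⟨(p, q), h⟩) = 𝒢'.mul ⟨(onP p, onP q), h'⟩

/-- An isomorphism of bundle gerbes with connection and curving: an isomorphism of bundle gerbes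
under which the connections and the curvings correspond. -/
structure GerbeConnCurv.Iso {X : Mfd.{u, v}} (𝒢 𝒢' : GerbeConnCurv X) extends
    BundleGerbe.Iso 𝒢.toBundleGerbe 𝒢'.toBundleGerbe where
  conn_eq : ∀ p, 𝒢'.conn (onP p) ∘L mfderiv 𝒢.P.tot.I 𝒢'.P.tot.I onP p = 𝒢.conn p
  curving_eq : 𝒢'.curving.pullback (onY : 𝒢.Y.Hom 𝒢'.Y) = 𝒢.curving

section PullbackGerbe

variable {X X' : Mfd.{u, v}} (φ : X'.Hom X)

namespace PreGerbe

variable (𝒢 : PreGerbe X)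

/-- The map `φ̃ : φ^*Y → Y`. -/
def tilde : (FibProd φ 𝒢.π 𝒢.subm).Hom 𝒢.Y := FibProd.snd φ 𝒢.π 𝒢.subm

/-- The map `φ̃^[2] : (φ^*Y)^[2] → Y^[2]`. -/
def tilde2 : (FibProd (FibProd.fst φ 𝒢.π 𝒢.subm) (FibProd.fst φ 𝒢.π 𝒢.subm)
    (FibProd.isSubm_fst φ 𝒢.π 𝒢.subm)).Hom 𝒢.Y2 :=
  FibProd.lift 𝒢.π 𝒢.π 𝒢.subm ((𝒢.tilde φ).comp (FibProd.fst _ _ _))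
    ((𝒢.tilde φ).comp (FibProd.snd _ _ _))
    (fun y => y.1.1.2.symm.trans ((congrArg φ y.2).trans y.1.2.2))

/-- The pair `((φ̃^[2])^*P, φ^*Y)`. -/
def pullback : PreGerbe X' where
  Y := FibProd φ 𝒢.π 𝒢.subm
  π := FibProd.fst φ 𝒢.π 𝒢.subm
  surjective x := by
    obtain ⟨y, hy⟩ := 𝒢.surjective (φ x)
    exact ⟨⟨(x, y), hy.symm⟩, rfl⟩
  F := 𝒢.F
  subm := FibProd.isSubm_fst φ 𝒢.π 𝒢.subm
  P := 𝒢.P.pullback (𝒢.tilde2 φ)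

/-- The map `(φ̃^[2])^*P → P`. -/
def tildeP : (𝒢.pullback φ).P.tot.Hom 𝒢.P.tot := 𝒢.P.pullbackMap (𝒢.tilde2 φ)

theorem src_tildeP (p : (𝒢.pullback φ).P.tot) :
    𝒢.src (𝒢.tildeP φ p) = 𝒢.tilde φ ((𝒢.pullback φ).src p) :=
  congrArg (fun y : 𝒢.Y2 => y.1.1) p.2.symm

theorem tgt_tildeP (p : (𝒢.pullback φ).P.tot) :
    𝒢.tgt (𝒢.tildeP φ p) = 𝒢.tilde φ ((𝒢.pullback φ).tgt p) :=
  congrArg (fun y : 𝒢.Y2 => y.1.2) p.2.symm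

end PreGerbe

/-- The pull-back `φ^*(P, Y) = ((φ̃^[2])^*P, φ^*Y)` of a bundle gerbe. -/
def BundleGerbe.pullback (𝒢 : BundleGerbe X) : BundleGerbe X' where
  toPreGerbe := 𝒢.toPreGerbe.pullback φ
  mul :=
    let 𝒢' := 𝒢.toPreGerbe.pullback φ
    let p₁ : 𝒢'.Comp.Hom 𝒢'.P.tot := FibProd.fst 𝒢'.tgt 𝒢'.src 𝒢'.src_isSubm
    let p₂ : 𝒢'.Comp.Hom 𝒢'.P.tot := FibProd.snd 𝒢'.tgt 𝒢'.src 𝒢'.src_isSubm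
    let base : 𝒢'.Comp.Hom 𝒢'.Y2 := FibProd.lift 𝒢'.π 𝒢'.π 𝒢'.subm (𝒢'.src.comp p₁)
      (𝒢'.tgt.comp p₂) (fun c => (𝒢'.π_src c.1.1).trans
        ((congrArg 𝒢'.π c.2).trans (𝒢'.π_src c.1.2)))
    let pair : 𝒢'.Comp.Hom 𝒢.toPreGerbe.Comp :=
      FibProd.lift 𝒢.toPreGerbe.tgt 𝒢.toPreGerbe.src 𝒢.toPreGerbe.src_isSubm
        ((𝒢.tildeP φ).comp p₁) ((𝒢.tildeP φ).comp p₂)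
        (fun c => (𝒢.tgt_tildeP φ c.1.1).trans ((congrArg (𝒢.tilde φ) c.2).trans
          (𝒢.src_tildeP φ c.1.2).symm))
    FibProd.lift (𝒢.tilde2 φ) 𝒢.P.proj 𝒢.P.isSubm base (𝒢.mul.comp pair) (fun c =>
      Subtype.ext (Prod.ext
        ((𝒢.src_tildeP φ c.1.1).symm.trans (𝒢.src_mul (pair c)).symm)
        ((𝒢.tgt_tildeP φ c.1.2).symm.trans (𝒢.tgt_mul (pair c)).symm)))
  src_mul _ := rfl
  tgt_mul _ := rfl
  mul_act _ _ _ _ _ _ := Subtype.ext (Prod.ext rfl (𝒢.mul_act _ _ _ _ _ _))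
  assoc _ _ _ _ _ _ _ := Subtype.ext (Prod.ext rfl (𝒢.assoc _ _ _ _ _ _ _))

/-- The pull-back `φ^*(P, ∇, f) = ((φ̃^[2])^*P, (φ̃^[2])^*∇, φ̃^*f)`. -/
def GerbeConnCurv.pullback (𝒢 : GerbeConnCurv X) : GerbeConnCurv X' where
  toBundleGerbe := 𝒢.toBundleGerbe.pullback φ
  conn p := 𝒢.conn (𝒢.tildeP φ p) ∘L
    mfderiv (𝒢.toPreGerbe.pullback φ).P.tot.I 𝒢.P.tot.I (𝒢.tildeP φ) p
  curving := 𝒢.curving.pullback (𝒢.tilde φ)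

end PullbackGerbe

section Lifting

variable {Γ Γh : LieGrp.{u, v}} (E : CentralExtension Γ Γh) {X X' : Mfd.{u, v}}

/-- The pair `(J_B, B)`, where `J_B = ζ^*Γh = {((b₁, b₂), x) | b₁ q(x) = b₂}`. -/
def liftingPreGerbe (B : PrincipalBundle Γ X) : PreGerbe X where
  Y := B.tot
  π := B.proj
  surjective := B.proj_surjective
  F := Γ.toMfd
  subm := B.isSubm
  P := E.bundle.pullback B.zeta

namespace liftingPreGerbe

variable {E} {B : PrincipalBundle Γ X}

/-- The map `J_B → Γh` covering `ζ`. -/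
def hat : (liftingPreGerbe E B).P.tot.Hom Γh.toMfd := E.bundle.pullbackMap B.zeta

/-- The map `J_B → B^[2] → B`, `((b₁, b₂), x) ↦ b₁`. -/
def pr₁ : (liftingPreGerbe E B).P.tot.Hom B.tot := (liftingPreGerbe E B).src

theorem act_hat (p : (liftingPreGerbe E B).P.tot) :
    B.act ((liftingPreGerbe E B).src p) (E.q (hat p)) = (liftingPreGerbe E B).tgt p := by
  have h : B.div p.1.1 = E.q (hat p) := p.2
  rw [← h]
  exact B.act_div p.1.1

theorem ext {p p' : (liftingPreGerbe E B).P.tot}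
    (h₁ : (liftingPreGerbe E B).src p = (liftingPreGerbe E B).src p')
    (h₂ : (liftingPreGerbe E B).tgt p = (liftingPreGerbe E B).tgt p')
    (h₃ : hat p = hat p') : p = p' :=
  Subtype.ext (Prod.ext (Subtype.ext (Prod.ext h₁ h₂)) h₃)

end liftingPreGerbe

/-- The lifting bundle gerbe `(J_B, B)`, with the product induced by that of `Γh`. -/
def liftingGerbe (B : PrincipalBundle Γ X) : BundleGerbe X where
  toPreGerbe := liftingPreGerbe E B
  mul :=
    let 𝒢 := liftingPreGerbe E B
    let p₁ : 𝒢.Comp.Hom 𝒢.P.tot := FibProd.fst 𝒢.tgt 𝒢.src 𝒢.src_isSubm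
    let p₂ : 𝒢.Comp.Hom 𝒢.P.tot := FibProd.snd 𝒢.tgt 𝒢.src 𝒢.src_isSubm
    let base : 𝒢.Comp.Hom 𝒢.Y2 := FibProd.lift 𝒢.π 𝒢.π 𝒢.subm (𝒢.src.comp p₁)
      (𝒢.tgt.comp p₂) (fun c => (𝒢.π_src c.1.1).trans
        ((congrArg 𝒢.π c.2).trans (𝒢.π_src c.1.2)))
    let prod : 𝒢.Comp.Hom Γh.toMfd :=
      ⟨fun c => (liftingPreGerbe.hat c.1.1 : Γh) * (liftingPreGerbe.hat c.1.2 : Γh),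
        ((ContMDiffMap.contMDiff liftingPreGerbe.hat).comp (ContMDiffMap.contMDiff p₁)).mul
        ((ContMDiffMap.contMDiff liftingPreGerbe.hat).comp (ContMDiffMap.contMDiff p₂))⟩
    FibProd.lift B.zeta E.qHom E.bundle.isSubm base prod (fun c => by
      refine B.div_eq _ _ ?_
      change B.act (𝒢.src c.1.1) (E.q ((liftingPreGerbe.hat c.1.1 : Γh) *
        (liftingPreGerbe.hat c.1.2 : Γh))) = 𝒢.tgt c.1.2
      have h : 𝒢.tgt c.1.1 = 𝒢.src c.1.2 := c.2
      have h₁ := liftingPreGerbe.act_hat (E := E) (B := B) c.1.1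
      have h₂ := liftingPreGerbe.act_hat (E := E) (B := B) c.1.2
      rw [map_mul]
      refine (B.act_mul _ _ _).trans ?_
      rw [h₁]
      exact (congrArg (fun b => B.act b (E.q (liftingPreGerbe.hat c.1.2))) h).trans h₂)
  src_mul _ := rfl
  tgt_mul _ := rfl
  mul_act p q s t h h' := by
    refine liftingPreGerbe.ext rfl rfl ?_
    change (liftingPreGerbe.hat p * E.ι s) * (liftingPreGerbe.hat q * E.ι t) =
      (liftingPreGerbe.hat p * liftingPreGerbe.hat q) * E.ι (s * t)
    rw [map_mul, mul_assoc, ← mul_assoc (E.ι s), E.central s]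
    simp only [mul_assoc]
  assoc p q r _ _ _ _ := by
    refine liftingPreGerbe.ext rfl rfl ?_
    exact mul_assoc (G := Γh) _ _ _

variable {E}

/-- The connection form `∇_{θ,σ} = ζ^*ν_σ + Z_σ(ζ⁻¹, π₁^*θ)` on `J_B`. -/
def liftingConn (σ : E.Split) {B : PrincipalBundle Γ X} (θ : Connection B)
    (p : (liftingPreGerbe E B).P.tot) :
    TangentSpace (liftingPreGerbe E B).P.tot.I p →L[ℝ] LieGrp.circle.Lie :=
  σ.nu (liftingPreGerbe.hat p) ∘L
      mfderiv (liftingPreGerbe E B).P.tot.I Γh.I liftingPreGerbe.hat p +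
    σ.Z (B.zeta ((liftingPreGerbe E B).P.proj p) : Γ)⁻¹ ∘L
      (θ.form.toFun (liftingPreGerbe.pr₁ p) ∘L
        mfderiv (liftingPreGerbe E B).P.tot.I B.tot.I liftingPreGerbe.pr₁ p)

/-- The 2-form `κ_{θ,σ}(b; v, w) = ℓ_σ(b, F_θ(b; v, w))` on `B`. -/
def liftingKappa (σ : E.Split) {B : PrincipalBundle Γ X} (θ : Connection B) (L : Splitting E B) :
    TwoForm B.tot LieGrp.circle.Lie where
  toFun b := (θ.curvature.toFun b).compr₂ (L.reduced σ b)
  alt b v := by simp [θ.curvature.alt]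

/-- The curving `f_{θ,σ} = - ½ ω_σ(θ, θ) - κ_{θ,σ}`, where `½ ω_σ(θ, θ)` is the 2-form
`(v, w) ↦ ω_σ(θ v, θ w)`. -/
def liftingCurving (σ : E.Split) {B : PrincipalBundle Γ X} (θ : Connection B)
    (L : Splitting E B) : TwoForm B.tot LieGrp.circle.Lie where
  toFun b := - σ.omega.compl₁₂ (θ.form.toFun b).toLinearMap (θ.form.toFun b).toLinearMap -
    (liftingKappa σ θ L).toFun b
  alt b v := by simp [σ.omega_self, (liftingKappa σ θ L).alt]

/-- The lifting bundle gerbe with connection and curving `(J_B, ∇_{θ,σ}, f_{θ,σ})` associated with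
`(B, θ, L)` and the split `σ`. -/
def liftingGerbeConnCurv (σ : E.Split) (D : BundleConnSplit E X) : GerbeConnCurv X where
  toBundleGerbe := liftingGerbe E D.B
  conn := liftingConn σ D.θ
  curving := liftingCurving σ D.θ D.L

end Lifting

section Natural

variable {Γ Γh : LieGrp.{u, v}} {E : CentralExtension Γ Γh}

/-- A morphism of principal bundles `B₁ → B` covering a smooth map `a : X₁ → X`. -/
structure BundleMap {X₁ X : Mfd.{u, v}} (a : X₁.Hom X) (B₁ : PrincipalBundle Γ X₁)
    (B : PrincipalBundle Γ X) where
  toHom : B₁.tot.Hom B.tot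
  proj_toHom : ∀ b, B.proj (toHom b) = a (B₁.proj b)
  toHom_act : ∀ b g, toHom (B₁.act b g) = B.act (toHom b) g

/-- The bundle map `φ^*B → B`. -/
def PrincipalBundle.tilde {X' X : Mfd.{u, v}} (φ : X'.Hom X) (B : PrincipalBundle Γ X) :
    BundleMap φ (B.pullback φ) B where
  toHom := B.pullbackMap φ
  proj_toHom b := b.2.symm
  toHom_act _ _ := rfl

/-- The map `J_{B₁} → J_B`, `((b₁, b₂), x) ↦ ((β b₁, β b₂), x)` induced by `β : B₁ → B`. -/
def BundleMap.onLifting {X₁ X : Mfd.{u, v}} {a : X₁.Hom X} {B₁ : PrincipalBundle Γ X₁}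
    {B : PrincipalBundle Γ X} (β : BundleMap a B₁ B) (p : (liftingGerbe E B₁).P.tot) :
    (liftingGerbe E B).P.tot :=
  ⟨(⟨(β.toHom p.1.1.1.1, β.toHom p.1.1.1.2), by
      rw [β.proj_toHom, β.proj_toHom]; exact congrArg a p.1.1.2⟩, p.1.2), by
    refine B.div_eq _ _ ?_
    have h : B₁.act p.1.1.1.1 (E.q p.1.2) = p.1.1.1.2 := liftingPreGerbe.act_hat (E := E) p
    exact (β.toHom_act _ _).symm.trans (congrArg β.toHom h)⟩

/-- A commutative square `φ ∘ a' = a ∘ φ₁` and a bundle map `β : B₁ → B` covering `a` induce a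
bundle map `φ₁^*B₁ → φ^*B` covering `a'`. -/
def BundleMap.pullback {X₁ X X₁' X' : Mfd.{u, v}} {a : X₁.Hom X} {B₁ : PrincipalBundle Γ X₁}
    {B : PrincipalBundle Γ X} (β : BundleMap a B₁ B) (φ₁ : X₁'.Hom X₁) (φ : X'.Hom X)
    (a' : X₁'.Hom X') (h : ∀ x, φ (a' x) = a (φ₁ x)) :
    BundleMap a' (B₁.pullback φ₁) (B.pullback φ) where
  toHom := FibProd.lift φ B.proj B.isSubm (a'.comp (B₁.pullback φ₁).proj)
    (β.toHom.comp (B₁.pullbackMap φ₁))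
    (fun b => (h _).trans ((congrArg a b.2).trans (β.proj_toHom _).symm))
  proj_toHom _ := rfl
  toHom_act _ _ := Subtype.ext (Prod.ext rfl (β.toHom_act _ _))

/-- The map `φ₁^*J_{B₁} → φ^*J_B` induced by a commutative square `φ ∘ a' = a ∘ φ₁` and a bundle map
`β : B₁ → B` covering `a`. -/
def BundleMap.onPullback {X₁ X X₁' X' : Mfd.{u, v}} {a : X₁.Hom X} {B₁ : PrincipalBundle Γ X₁}
    {B : PrincipalBundle Γ X} (β : BundleMap a B₁ B) (φ₁ : X₁'.Hom X₁) (φ : X'.Hom X)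
    (a' : X₁'.Hom X') (h : ∀ x, φ (a' x) = a (φ₁ x))
    (p : ((liftingGerbe E B₁).pullback φ₁).P.tot) : ((liftingGerbe E B).pullback φ).P.tot :=
  ⟨(⟨((β.pullback φ₁ φ a' h).toHom p.1.1.1.1, (β.pullback φ₁ φ a' h).toHom p.1.1.1.2),
      congrArg a' p.1.1.2⟩, β.onLifting p.1.2),
    Subtype.ext (Prod.ext
      (congrArg (fun y : B₁.sq => β.toHom y.1.1) p.2)
      (congrArg (fun y : B₁.sq => β.toHom y.1.2) p.2))⟩

end Natural

end

/-!
A point of `φ^*J_B` is a pair of points of `φ^*B` in the same fibre together with a point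
`((b₁, b₂), x)` of `J_B` over their images in `B`. As `(b₁, b₂)` is determined by the pair, the
only further information is `x : Γh`, and forgetting `(b₁, b₂)` identifies `φ^*J_B` with `J_{φ^*B}`
(`liftingGerbe.pullbackDiffeomorph`). The projections to `φ^*B`, the `𝕋`-actions and the products,
which are those of `Γh`, correspond by construction. So do the maps induced by a bundle map `β`, as
they leave `x` unchanged; this gives compatibility with the canonical maps and naturality.

The connections correspond because the pull-back of `∇_{θ,σ}` to a manifold over `J_B` depends only
on the components in `Γh` and in the first factor `B`, through `ν_σ`, `Z_σ` and the pull-back of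
`θ` (`liftingConn_comp_mfderiv`, `liftingConn_pullback`).

For the curvings the point is that the curvature is natural, `F_{φ̃^*θ} = φ̃^*F_θ`
(`Connection.curvature_pullback`), that is, that the exterior derivative of 1-forms commutes with
pull-backs (`OneForm.d_pullback`). In charts this is the chain rule together with the symmetry of
second derivatives (`fderiv_comp_fderiv_sub_flip`). It needs the coordinate expression of a smooth
1-form to be differentiable as a map into the space of continuous linear maps, although smoothness
of a form is defined by joint smoothness on the tangent bundle (`OneForm.contDiffOn_inChart`).
-/

/-! ### Calculus in normed spaces -/

section Calculus

variable {E F V : Type*} [NormedAddCommGroup E] [NormedSpace ℝ E] [NormedAddCommGroup F]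
  [NormedSpace ℝ F] [NormedAddCommGroup V] [NormedSpace ℝ V]

/-- A family of continuous linear maps that is jointly smooth as a function of the parameter and
the argument is smooth for the operator norm: `α x` is the partial derivative of
`(x, w) ↦ α x w` in the second variable at `w = 0`. -/
theorem ContDiffOn.clm_of_uncurry {s : Set E} (hs : IsOpen s) {α : E → F →L[ℝ] V}
    (h : ContDiffOn ℝ ∞ (fun q : E × F => α q.1 q.2) (s ×ˢ Set.univ)) : ContDiffOn ℝ ∞ α s := by
  have hopen : IsOpen (s ×ˢ (Set.univ : Set F)) := hs.prod isOpen_univ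
  have h1 : ContDiffOn ℝ ∞ (fun x : E => fderiv ℝ (fun q : E × F => α q.1 q.2) (x, 0)) s :=
    (h.fderiv_of_isOpen (m := ∞) hopen (by simp)).comp
      (contDiff_id.prodMk contDiff_const).contDiffOn (fun x hx => ⟨hx, trivial⟩)
  refine (h1.clm_comp
    (contDiffOn_const (c := ContinuousLinearMap.inr ℝ E F))).congr fun x hx => ?_
  have h2 : DifferentiableAt ℝ (fun q : E × F => α q.1 q.2) (x, 0) :=
    (h.contDiffAt (hopen.mem_nhds ⟨hx, trivial⟩)).differentiableAt (by simp)
  have h3 : HasFDerivAt (fun w : F => ((x, w) : E × F)) (ContinuousLinearMap.inr ℝ E F) 0 :=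
    hasFDerivAt_prodMk_right x 0
  have h4 := h2.hasFDerivAt.comp (0 : F) h3
  exact (α x).hasFDerivAt.unique h4

/-- The exterior derivative commutes with pull-back, for 1-forms `α` on normed spaces: the term of
`D(α(g y) ∘ Dg(y))` that contains the second derivative of `g` is symmetric. -/
theorem fderiv_comp_fderiv_sub_flip {α : F → F →L[ℝ] V} {g : E → F} {x : E}
    (hα : DifferentiableAt ℝ α (g x)) (hg : ContDiffAt ℝ 2 g x) (v w : E) :
    fderiv ℝ (fun y => α (g y) ∘L fderiv ℝ g y) x v w -
        fderiv ℝ (fun y => α (g y) ∘L fderiv ℝ g y) x w v =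
      fderiv ℝ α (g x) (fderiv ℝ g x v) (fderiv ℝ g x w) -
        fderiv ℝ α (g x) (fderiv ℝ g x w) (fderiv ℝ g x v) := by
  have hg1 : DifferentiableAt ℝ g x := hg.differentiableAt (by simp)
  have hg2 : DifferentiableAt ℝ (fderiv ℝ g) x :=
    (hg.fderiv_right (m := 1) (by norm_num)).differentiableAt (by simp)
  have hsymm : IsSymmSndFDerivAt ℝ g x := hg.isSymmSndFDerivAt (by simp)
  have h := (hα.hasFDerivAt.comp x hg1.hasFDerivAt).clm_comp hg2.hasFDerivAt
  rw [HasFDerivAt.fderiv (f := fun y => α (g y) ∘L fderiv ℝ g y) h]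
  simp [hsymm v w]

end Calculus

/-! ### Exterior derivative and pull-back of 1-forms -/

namespace Mfd

theorem contMDiffAt_extChart_symm {M : Mfd.{u, v}} {p : M} {x : M.modelSpace}
    (hx : x ∈ (extChartAt M.I p).target) :
    ContMDiffAt 𝓘(ℝ, M.modelSpace) M.I ∞ (extChartAt M.I p).symm x :=
  (contMDiffOn_extChartAt_symm (I := M.I) (n := ∞) p).contMDiffAt
    ((isOpen_extChartAt_target p).mem_nhds hx)

theorem contDiffAt_writtenInExtChartAt {M : Mfd.{u, v}} {N : Mfd.{u₁, v₁}} (f : N.Hom M) (p : N)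
    {x : N.modelSpace}
    (hx : x ∈ (extChartAt N.I p).target)
    (hx' : f ((extChartAt N.I p).symm x) ∈ (extChartAt M.I (f p)).source) :
    ContDiffAt ℝ ∞ (writtenInExtChartAt N.I M.I p f) x := by
  rw [← contMDiffAt_iff_contDiffAt]
  have h1 := contMDiffAt_extChartAt' (I := M.I) (n := ∞) (x := f p)
    (x' := f ((extChartAt N.I p).symm x)) (by rwa [← extChartAt_source M.I])
  exact h1.comp x ((ContMDiffMap.contMDiff f).contMDiffAt.comp x (contMDiffAt_extChart_symm hx))

end Mfd

namespace OneForm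

open Mfd

variable {M : Mfd.{u, v}} {V : Type w} [NormedAddCommGroup V] [NormedSpace ℝ V]

/-- The coordinate expression of a smooth 1-form is smooth for the operator norm; in particular the
`fderiv` in the definition of `OneForm.d` is a genuine derivative. -/
theorem contDiffOn_inChart (θ : OneForm M V) (p : M) :
    ContDiffOn ℝ ∞ (θ.inChart p) (extChartAt M.I p).target := by
  have ho : IsOpen (extChartAt M.I p).target := isOpen_extChartAt_target p
  refine ContDiffOn.clm_of_uncurry ho ?_
  have h1 := (contMDiffOn_extChartAt_symm (I := M.I) (n := ∞) p).contMDiffOn_tangentMapWithin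
    (m := ∞) (by simp) ho.uniqueMDiffOn
  have h2 := θ.smooth.comp_contMDiffOn h1
  have h3 : ContMDiff 𝓘(ℝ, M.modelSpace × M.modelSpace) 𝓘(ℝ, M.modelSpace).tangent ∞
      (fun q : M.modelSpace × M.modelSpace =>
        (⟨q.1, q.2⟩ : TangentBundle 𝓘(ℝ, M.modelSpace) M.modelSpace)) := by
    have := contMDiff_tangentBundleModelSpaceHomeomorph_symm
      (I := 𝓘(ℝ, M.modelSpace)) (n := ∞)
    have hI : 𝓘(ℝ, M.modelSpace).tangent = 𝓘(ℝ, M.modelSpace × M.modelSpace) :=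
      modelWithCornersSelf_prod.symm
    rw [hI] at this
    exact this
  rw [← contMDiffOn_iff_contDiffOn]
  refine (h2.comp h3.contMDiffOn (fun x hx => hx.1)).congr ?_
  rintro ⟨x, w⟩ ⟨hx, -⟩
  have := mfderivWithin_of_isOpen (I := 𝓘(ℝ, M.modelSpace)) (I' := M.I)
    (f := (extChartAt M.I p).symm) ho hx
  change θ.toFun ((extChartAt M.I p).symm x)
      (mfderiv 𝓘(ℝ, M.modelSpace) M.I (extChartAt M.I p).symm x w) =
    θ.toFun ((extChartAt M.I p).symm x)
      (mfderivWithin 𝓘(ℝ, M.modelSpace) M.I (extChartAt M.I p).symm (extChartAt M.I p).target x w)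
  rw [this]

variable {N : Mfd.{u₁, v₁}} (f : N.Hom M)

theorem inChart_pullback (θ : OneForm M V) (p : N) {x : N.modelSpace}
    (hx : x ∈ (extChartAt N.I p).target)
    (hx' : f ((extChartAt N.I p).symm x) ∈ (extChartAt M.I (f p)).source) :
    (θ.pullback f).inChart p x =
      θ.inChart (f p) (writtenInExtChartAt N.I M.I p f x) ∘L
        fderiv ℝ (writtenInExtChartAt N.I M.I p f) x := by
  have hsymm := contMDiffAt_extChart_symm hx
  have hf := (ContMDiffMap.contMDiff f)
  have htgt : writtenInExtChartAt N.I M.I p f x ∈ (extChartAt M.I (f p)).target :=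
    (extChartAt M.I (f p)).map_source hx'
  have h1 := mfderiv_comp (I := 𝓘(ℝ, N.modelSpace)) (I' := N.I) (I'' := M.I) x
    (hf.mdifferentiable (by simp) ((extChartAt N.I p).symm x))
    (hsymm.mdifferentiableAt (by simp))
  have h2 := mfderiv_comp (I := 𝓘(ℝ, N.modelSpace)) (I' := 𝓘(ℝ, M.modelSpace)) (I'' := M.I) x
    ((contMDiffAt_extChart_symm htgt).mdifferentiableAt (by simp))
    ((contDiffAt_writtenInExtChartAt f p hx hx').contMDiffAt.mdifferentiableAt (by simp))
  have heq : (extChartAt M.I (f p)).symm ∘ writtenInExtChartAt N.I M.I p f =ᶠ[𝓝 x]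
      f ∘ (extChartAt N.I p).symm := by
    have hc : ContinuousAt (f ∘ (extChartAt N.I p).symm) x :=
      hf.continuous.continuousAt.comp hsymm.continuousAt
    filter_upwards [hc.preimage_mem_nhds ((isOpen_extChartAt_source (f p)).mem_nhds hx')] with y hy
    exact (extChartAt M.I (f p)).left_inv hy
  have h3 := heq.mfderiv_eq (I := 𝓘(ℝ, N.modelSpace)) (I' := M.I)
  have hpt : (extChartAt M.I (f p)).symm (writtenInExtChartAt N.I M.I p f x) =
      f ((extChartAt N.I p).symm x) := (extChartAt M.I (f p)).left_inv hx'
  rw [← mfderiv_eq_fderiv]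
  ext w
  have h4 := DFunLike.congr_fun (h1.symm.trans (h3.symm.trans h2)) w
  change θ.toFun _ _ = θ.toFun _ _
  refine (congrArg (θ.toFun (f ((extChartAt N.I p).symm x))) h4).trans ?_
  have : ∀ q q' : M, q = q' → ∀ y : M.modelSpace, (θ.toFun q y : V) = θ.toFun q' y := by
    rintro q _ rfl y; rfl
  exact this _ _ hpt.symm _

/-- The exterior derivative is natural: `d (f^*θ) = f^* (dθ)`. -/
theorem d_pullback (θ : OneForm M V) (p : N) (v w : TangentSpace N.I p) :
    (θ.pullback f).d p v w = θ.d (f p) (mfderiv N.I M.I f p v) (mfderiv N.I M.I f p w) := by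
  set e := extChartAt N.I p with he
  set e' := extChartAt M.I (f p) with he'
  set g := writtenInExtChartAt N.I M.I p f with hgdef
  have hf := (ContMDiffMap.contMDiff f)
  have hx : e p ∈ e.target := mem_extChartAt_target p
  have hep : e.symm (e p) = p := extChartAt_to_inv p
  have hx' : f (e.symm (e p)) ∈ e'.source := by rw [hep]; exact mem_extChartAt_source (f p)
  have hgx : g (e p) = e' (f p) := by
    change e' (f (e.symm (e p))) = _
    rw [hep]
  have hev : (θ.pullback f).inChart p =ᶠ[𝓝 (e p)]
      fun y => θ.inChart (f p) (g y) ∘L fderiv ℝ g y := by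
    have hc : ContinuousAt (f ∘ e.symm) (e p) :=
      hf.continuous.continuousAt.comp (contMDiffAt_extChart_symm hx).continuousAt
    filter_upwards [hc.preimage_mem_nhds ((isOpen_extChartAt_source (f p)).mem_nhds hx'),
      (isOpen_extChartAt_target p).mem_nhds hx] with y hy hy'
    exact inChart_pullback f θ p hy' hy
  have hα : DifferentiableAt ℝ (θ.inChart (f p)) (g (e p)) := by
    rw [hgx]
    exact ((θ.contDiffOn_inChart (f p)).contDiffAt ((isOpen_extChartAt_target (f p)).mem_nhds
      (mem_extChartAt_target (f p)))).differentiableAt (by simp)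
  have hg : ContDiffAt ℝ ∞ g (e p) := contDiffAt_writtenInExtChartAt f p hx hx'
  -- the differential of `g` at `e p` is that of `f` read in the charts
  have hg1 : ∀ u : TangentSpace N.I p, fderiv ℝ g (e p) (mfderiv N.I 𝓘(ℝ, N.modelSpace) e p u) =
      (mfderiv M.I 𝓘(ℝ, M.modelSpace) e' (f p) (mfderiv N.I M.I f p u) : M.modelSpace) := by
    intro u
    have h1 := mfderiv_comp (I := N.I) (I' := 𝓘(ℝ, N.modelSpace)) (I'' := 𝓘(ℝ, M.modelSpace)) p
      (hg.contMDiffAt.mdifferentiableAt (by simp))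
      ((contMDiffAt_extChartAt (I := N.I) (n := ∞)).mdifferentiableAt (by simp))
    have h2 := mfderiv_comp (I := N.I) (I' := M.I) (I'' := 𝓘(ℝ, M.modelSpace)) p
      ((contMDiffAt_extChartAt (I := M.I) (n := ∞)).mdifferentiableAt (by simp))
      (hf.mdifferentiable (by simp) p)
    have heq : g ∘ e =ᶠ[𝓝 p] e' ∘ f := by
      filter_upwards [(isOpen_extChartAt_source (I := N.I) p).mem_nhds
        (mem_extChartAt_source p)] with y hy
      exact congrArg (fun y => e' (f y)) (e.left_inv hy)
    have h3 := heq.mfderiv_eq (I := N.I) (I' := 𝓘(ℝ, M.modelSpace))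
    rw [mfderiv_eq_fderiv] at h1
    exact DFunLike.congr_fun (h1.symm.trans (h3.trans h2)) u
  have key := fderiv_comp_fderiv_sub_flip hα (hg.of_le (by norm_cast))
    (mfderiv N.I 𝓘(ℝ, N.modelSpace) e p v) (mfderiv N.I 𝓘(ℝ, N.modelSpace) e p w)
  rw [← hev.fderiv_eq, hg1, hg1, hgx] at key
  exact key

end OneForm

theorem OneForm.pullback_pullback {K : Mfd.{u₂, v₂}} {N : Mfd.{u₁, v₁}} {M : Mfd.{u, v}}
    {V : Type w} [NormedAddCommGroup V] [NormedSpace ℝ V] (θ : OneForm M V) (f : N.Hom M)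
    (g : K.Hom N) (x : K) (v : TangentSpace K.I x) :
    ((θ.pullback f).pullback g).toFun x v = (θ.pullback (f.comp g)).toFun x v := by
  have h := mfderiv_comp (I := K.I) (I' := N.I) (I'' := M.I) x
    ((ContMDiffMap.contMDiff f).mdifferentiable (by simp) (g x))
    ((ContMDiffMap.contMDiff g).mdifferentiable (by simp) x)
  exact congrArg (θ.toFun (f (g x))) (DFunLike.congr_fun h v).symm

/-! ### Curvature and curving -/

section Curving

variable {Γ Γh : LieGrp.{u, v}} {E : CentralExtension Γ Γh} {X X' : Mfd.{u, v}} (φ : X'.Hom X)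
  {B : PrincipalBundle Γ X}

theorem Connection.curvature_pullback (θ : Connection B) :
    (θ.pullback φ).curvature = θ.curvature.pullback (B.pullbackMap φ) := by
  ext b v w
  exact congrArg (· + _) (OneForm.d_pullback (B.pullbackMap φ) θ.form b v w)

theorem Splitting.reduced_pullback (σ : E.Split) (L : Splitting E B)
    (b : (B.pullback φ).tot) :
    (L.pullback φ).reduced σ b = L.reduced σ (B.pullbackMap φ b) :=
  LinearMap.ext fun x => congrArg Assoc.coord (L.pullbackFun_mk φ b (σ.toCLM x))

theorem liftingCurving_pullback (σ : E.Split) (θ : Connection B) (L : Splitting E B) :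
    liftingCurving σ (θ.pullback φ) (L.pullback φ) =
      (liftingCurving σ θ L).pullback (B.pullbackMap φ) := by
  ext b v w
  refine congrArg (fun z : LieGrp.circle.Lie =>
    (-σ.omega.compl₁₂ ((θ.pullback φ).form.toFun b).toLinearMap
      ((θ.pullback φ).form.toFun b).toLinearMap) v w - z) ?_
  change (L.pullback φ).reduced σ b ((θ.pullback φ).curvature.toFun b v w) = _
  rw [Connection.curvature_pullback, Splitting.reduced_pullback]
  rfl

theorem TwoForm.pullback_refl {M : Mfd.{u, v}} {V : Type w} [NormedAddCommGroup V]
    [NormedSpace ℝ V] (α : TwoForm M V) :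
    α.pullback (Diffeomorph.refl M.I M ∞ : M.Hom M) = α := by
  ext p v w
  have h : mfderiv M.I M.I (Diffeomorph.refl M.I M ∞ : M.Hom M) p =
      ContinuousLinearMap.id ℝ (TangentSpace M.I p) := mfderiv_id
  change α.toFun p (mfderiv M.I M.I (Diffeomorph.refl M.I M ∞ : M.Hom M) p v)
    (mfderiv M.I M.I (Diffeomorph.refl M.I M ∞ : M.Hom M) p w) = _
  rw [h]
  rfl

end Curving

/-! ### The lifting gerbe and its connection -/

section Iso

variable {Γ Γh : LieGrp.{u, v}} {E : CentralExtension Γ Γh} {X X' : Mfd.{u, v}}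

/-- The diffeomorphism `φ^*J_B → J_{φ^*B}`, `(y, ((b₁, b₂), x)) ↦ (y, x)` for `y` in
`(φ^*B)^[2]`. In the inverse, `(b₁, b₂)` is recovered as the image of `y` in `B^[2]`. -/
noncomputable def liftingGerbe.pullbackDiffeomorph (E : CentralExtension Γ Γh) (φ : X'.Hom X)
    (B : PrincipalBundle Γ X) :
    Diffeomorph ((liftingGerbe E B).pullback φ).P.tot.I (liftingGerbe E (B.pullback φ)).P.tot.I
      ((liftingGerbe E B).pullback φ).P.tot (liftingGerbe E (B.pullback φ)).P.tot ∞ :=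
  let a : ((liftingGerbe E B).pullback φ).P.tot.Hom (liftingGerbe E (B.pullback φ)).P.tot :=
    FibProd.lift (B.pullback φ).zeta E.qHom E.bundle.isSubm
      ((liftingGerbe E B).pullback φ).P.proj
      (liftingPreGerbe.hat.comp ((liftingGerbe E B).tildeP φ))
      (fun p => (B.pullback φ).div_eq _ _ <| Subtype.ext <| Prod.ext p.1.1.2 <| by
        have h := liftingPreGerbe.act_hat ((liftingGerbe E B).tildeP φ p)
        have h₁ := (liftingGerbe E B).src_tildeP φ p
        have h₂ := (liftingGerbe E B).tgt_tildeP φ p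
        exact (congrArg (fun b => B.act b _) h₁.symm).trans (h.trans h₂))
  let inv : (liftingGerbe E (B.pullback φ)).P.tot.Hom ((liftingGerbe E B).pullback φ).P.tot :=
    FibProd.lift ((liftingGerbe E B).tilde2 φ) (liftingGerbe E B).P.proj
      (liftingGerbe E B).P.isSubm (liftingGerbe E (B.pullback φ)).P.proj
      (FibProd.lift B.zeta E.qHom E.bundle.isSubm
        (((liftingGerbe E B).tilde2 φ).comp (liftingGerbe E (B.pullback φ)).P.proj)
        liftingPreGerbe.hat
        (fun p => B.div_eq _ _
          (congrArg (B.pullbackMap φ) (liftingPreGerbe.act_hat (E := E) p))))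
      (fun _ => rfl)
  { toFun := a
    invFun := inv
    left_inv := fun p => Subtype.ext (Prod.ext rfl (Subtype.ext (Prod.ext p.2 rfl)))
    right_inv := fun _ => rfl
    contMDiff_toFun := ContMDiffMap.contMDiff a
    contMDiff_invFun := ContMDiffMap.contMDiff inv }

/-- The pull-back of `∇_{θ,σ}` along a map `F` into `J_B` depends only on the components
`hat ∘ F` and `pr₁ ∘ F`, since `ζ` is the image of `hat` under `q`. -/
theorem liftingConn_comp_mfderiv (σ : E.Split) {B : PrincipalBundle Γ X} (θ : Connection B)
    {M : Mfd.{u, v}} (F : M.Hom (liftingPreGerbe E B).P.tot) (x : M) :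
    liftingConn σ θ (F x) ∘L mfderiv M.I (liftingPreGerbe E B).P.tot.I F x =
      σ.nu (liftingPreGerbe.hat.comp F x) ∘L mfderiv M.I Γh.I (liftingPreGerbe.hat.comp F) x +
        σ.Z (E.q (liftingPreGerbe.hat.comp F x))⁻¹ ∘L
          (θ.form.pullback (liftingPreGerbe.pr₁.comp F)).toFun x := by
  have hF := (ContMDiffMap.contMDiff F).mdifferentiable (by simp) x
  have h1 := mfderiv_comp (I := M.I) (I' := (liftingPreGerbe E B).P.tot.I) (I'' := Γh.I) x
    ((ContMDiffMap.contMDiff liftingPreGerbe.hat).mdifferentiable (by simp) (F x)) hF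
  have h2 := mfderiv_comp (I := M.I) (I' := (liftingPreGerbe E B).P.tot.I) (I'' := B.tot.I) x
    ((ContMDiffMap.contMDiff liftingPreGerbe.pr₁).mdifferentiable (by simp) (F x)) hF
  have h3 : (B.zeta ((liftingPreGerbe E B).P.proj (F x)) : Γ) = E.q (liftingPreGerbe.hat (F x)) :=
    (F x).2
  ext v
  have h1' := DFunLike.congr_fun h1 v
  have h2' := DFunLike.congr_fun h2 v
  refine (congrArg₂ (fun (y : LieGrp.circle.Lie) z => y + z)
    (congrArg (σ.nu (liftingPreGerbe.hat (F x))) h1')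
    (congrArg₂ (fun (γ : Γ) z => σ.Z γ⁻¹ (θ.form.toFun (liftingPreGerbe.pr₁ (F x)) z))
      h3.symm h2')).symm

/-- Maps `F` into `J_B` and `F'` into `J_{φ^*B}` that correspond to each other under
`J_{φ^*B} → J_B` pull the connections `∇_{θ,σ}` and `∇_{φ̃^*θ,σ}` back to the same form. -/
theorem liftingConn_pullback (σ : E.Split) (φ : X'.Hom X) {B : PrincipalBundle Γ X}
    (θ : Connection B) {M : Mfd.{u, v}} (F : M.Hom (liftingPreGerbe E B).P.tot)
    (F' : M.Hom (liftingPreGerbe E (B.pullback φ)).P.tot)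
    (hhat : liftingPreGerbe.hat.comp F' = liftingPreGerbe.hat.comp F)
    (hpr : (B.pullbackMap φ).comp (liftingPreGerbe.pr₁.comp F') = liftingPreGerbe.pr₁.comp F)
    (x : M) :
    liftingConn σ (θ.pullback φ) (F' x) ∘L
        mfderiv M.I (liftingPreGerbe E (B.pullback φ)).P.tot.I F' x =
      liftingConn σ θ (F x) ∘L mfderiv M.I (liftingPreGerbe E B).P.tot.I F x := by
  have h : ((θ.form.pullback (B.pullbackMap φ)).pullback (liftingPreGerbe.pr₁.comp F')).toFun x =
      (θ.form.pullback (liftingPreGerbe.pr₁.comp F)).toFun x := by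
    rw [← hpr]
    exact ContinuousLinearMap.ext fun v => OneForm.pullback_pullback _ _ _ _ _
  refine (liftingConn_comp_mfderiv σ (θ.pullback φ) F' x).trans
    (Eq.trans ?_ (liftingConn_comp_mfderiv σ θ F x).symm)
  rw [hhat, ← h]
  rfl

/-- The isomorphism `φ^*(J_B, ∇_{θ,σ}, f_{θ,σ}) ≅ (J_{φ^*B}, ∇_{φ̃^*θ,σ}, f_{φ̃^*θ,σ})` over the
identity of `φ^*B`. -/
noncomputable def liftingIso (σ : E.Split) (φ : X'.Hom X) (D : BundleConnSplit E X) :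
    GerbeConnCurv.Iso ((liftingGerbeConnCurv σ D).pullback φ)
          (liftingGerbeConnCurv σ (D.pullback φ)) where
  onY := Diffeomorph.refl (D.B.pullback φ).tot.I (D.B.pullback φ).tot ∞
  π_onY _ := rfl
  onP := liftingGerbe.pullbackDiffeomorph E φ D.B
  onP_act _ _ := rfl
  src_onP _ := rfl
  tgt_onP _ := rfl
  onP_mul _ _ _ _ := rfl
  conn_eq := liftingConn_pullback σ φ D.θ ((liftingGerbe E D.B).tildeP φ)
    ⟨_, (liftingGerbe.pullbackDiffeomorph E φ D.B).contMDiff⟩ rfl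
    (ContMDiffMap.ext fun p => ((liftingGerbe E D.B).src_tildeP φ p).symm)
  curving_eq := (TwoForm.pullback_refl _).trans (liftingCurving_pullback φ σ D.θ D.L)

end Iso

/-- **Naturality of the lifting bundle gerbe.** The isomorphism `Φ φ D` lies over the identity of
`φ^*B`, is compatible with the canonical maps `φ^*J_B → J_B` and `J_{φ^*B} → J_B`, and is natural
with respect to bundle maps over commutative squares `φ ∘ a' = a ∘ φ₁`. -/
theorem mainTheorem6 {Γ Γh : LieGrp.{u, v}} (E : CentralExtension Γ Γh) (σ : E.Split) :
    ∃ Φ : ∀ {X X' : Mfd.{u, v}} (φ : X'.Hom X) (D : BundleConnSplit E X),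
        GerbeConnCurv.Iso ((liftingGerbeConnCurv σ D).pullback φ)
          (liftingGerbeConnCurv σ (D.pullback φ)),
      (∀ {X X' : Mfd.{u, v}} (φ : X'.Hom X) (D : BundleConnSplit E X),
        (∀ y, (Φ φ D).onY y = y) ∧
        ∀ p, (D.B.tilde φ).onLifting ((Φ φ D).onP p) = (liftingGerbe E D.B).tildeP φ p) ∧
      (∀ {X₁ X X₁' X' : Mfd.{u, v}} (a : X₁.Hom X) (φ₁ : X₁'.Hom X₁) (φ : X'.Hom X)
        (a' : X₁'.Hom X') (h : ∀ x, φ (a' x) = a (φ₁ x)) (D₁ : BundleConnSplit E X₁)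
        (D : BundleConnSplit E X) (β : BundleMap a D₁.B D.B) (p),
        (β.pullback φ₁ φ a' h).onLifting ((Φ φ₁ D₁).onP p) =
          (Φ φ D).onP (β.onPullback φ₁ φ a' h p)) :=
  ⟨liftingIso σ, fun _ _ => ⟨fun _ => rfl, fun p => Subtype.ext (Prod.ext p.2 rfl)⟩,
    fun _ _ _ _ _ _ _ _ _ => rfl⟩
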